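/- Let $(\Omega,\mathcal F,\mathbb P)$ be an atomless probability space and let $\mathbb Q$ be a probability measure with $\mathbb Q\ll\mathbb P$. Positive values of a random variable are losses. For $X\in L^1$ let $\mathrm{VaR}_q(X)=\inf\{t\in\mathbb R:\mathbb P(X\le t)\ge q\}$ for $q\in(0,1]$, $\mathrm{ES}_p(X)=\frac1{1-p}\int_p^1\mathrm{VaR}_q(X)\,dq$ for $p\in[0,1)$ and $\mathrm{ES}_1(X)=\operatorname{ess\,sup}X$. We say that $X$ has ES profile $g$ if $\mathrm{ES}_p(X)=g(p)$ for all $p\in[0,1]$, and we write $X\ge_{\rm SSD}Y$ if $\mathbb E[v(-X)]\ge\mathbb E[v(-Y)]$ for every increasing concave $v:\mathbb R\to\mathbb R$. Let $\mathcal G_{\rm ES}$ be the set of increasing functions $g:[0,1]\to(-\infty,\infty]$ that are finite on $[0,1)$, left-continuous on $[0,1]$ and right-continuous at $0$, and such that $h_g(p)=(1-p)g(p)$ (with $0\cdot\infty=0$) is concave on $(0,1)$ and left-continuous at $1$. Let $g\in\mathcal G_{\rm ES}$ be such that $g(p)\le g(0)+Cp$ for all $p\in[0,1]$ and some constant $C\in\mathbb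 R$. Put $$\rho(X)=\mathrm{ES}^g(X)=\inf\{m\in\mathbb R:\ \mathrm{ES}_p(X-m)\le g(p)\ \ \forall p\in[0,1]\},\qquad X\in L^\infty .$$ Let $w,x\in\mathbb R$. Let $u:\mathbb R\to\mathbb R\cup\{-\infty\}$ be concave, increasing and right-continuous (the last condition only matters at the point where $u$ may become $-\infty$), and let $\rho':L^\infty\to[-\infty,\infty]$ be continuous for the $L^\infty$-norm and SSD-consistent, i.e. $\rho'(X)\le\rho'(Y)$ whenever $X\ge_{\rm SSD}Y$. Consider the following problems over $X\in L^\infty$: (A) minimize $\rho(X)$ subject to $\mathbb E_{\mathbb Q}[w-X]\le x$; (B) minimize $\mathbb E_{\mathbb Q}[w-X]$ subject to $\rho(X)\le x$; (C) minimize $\rho(X)$ subject to $\mathbb E[u(w-X)]=x$; (D) minimize $\mathbb E[u(w-X)]$ subject to $\rho(X)=x$; (E) maximize $\rho'(X)$ subject to $\rho(X)=x$. In (C) assume in addition that $\lim_{y\to-\infty}u(y)<x<\lim_{y\to\infty}u(y)$ and that, if $a:=\inf\{y:u(y)>-\infty\}$ is finite, then $\mathbb E[u(a+g(1)-Z)]\le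 x$ for $Z\in L^\infty$ with ES profile $g$ (this value depends only on the law of $Z$, which is determined by $g$). Then there is a $Z\in L^\infty$ that has ES profile $g$ and is comonotonic with $d\mathbb Q/d\mathbb P$. Moreover: (i) For every $Z\in L^\infty$ that has ES profile $g$ and is comonotonic with $d\mathbb Q/d\mathbb P$, there is exactly one $z\in\mathbb R$ with $\mathbb E_{\mathbb Q}[w-(Z+z)]=x$, and for this $z$ the position $Z+z$ is an optimal solution of (A); likewise there is exactly one $z\in\mathbb R$ with $\rho(Z+z)=x$, and for this $z$ the position $Z+z$ is an optimal solution of (B). (ii) For every $Z\in L^\infty$ that has ES profile $g$ and for each of the problems (C), (D), (E), there is exactly one $z\in\mathbb R$ for which $Z+z$ satisfies the constraint of the problem, and for this $z$ the position $Z+z$ is an optimal solution of the problem. -/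

import Mathlib

open MeasureTheory Set Filter Topology
open scoped ENNReal

noncomputable section

namespace AdjES

variable {Ω : Type*} [MeasurableSpace Ω]

/-- Every event of positive probability can be split into two events of positive probability. -/
def Atomless (P : Measure Ω) : Prop :=
  ∀ A : Set Ω, MeasurableSet A → 0 < P A →
    ∃ B : Set Ω, MeasurableSet B ∧ B ⊆ A ∧ 0 < P B ∧ P B < P A

/-- Value at Risk at level `p ∈ [0,1]` (left quantile; essential infimum for `p = 0`). -/
def VaR (P : Measure Ω) (p : ℝ) (X : Ω → ℝ) : EReal :=
  if p = 0 then essInf (fun ω => (X ω : EReal)) P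
  else sInf ((fun t : ℝ => (t : EReal)) '' {t : ℝ | ENNReal.ofReal p ≤ P {ω | X ω ≤ t}})

/-- Expected Shortfall at level `p ∈ [0,1]` of an integrable random variable
(essential supremum for `p = 1`). `VaR P q X` is finite for `0 < q < 1`. -/
def ES (P : Measure Ω) (p : ℝ) (X : Ω → ℝ) : EReal :=
  if p = 1 then essSup (fun ω => (X ω : EReal)) P
  else ((1 / (1 - p) * ∫ q in p..1, (VaR P q X).toReal : ℝ) : EReal)

/-- Risk profiles: increasing functions `[0,1] → (-∞,∞]` that are not identically `∞`.
Only the values on `[0,1]` matter. -/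
def IsProfile (g : ℝ → EReal) : Prop :=
  MonotoneOn g (Icc 0 1) ∧ (∀ p ∈ Icc (0 : ℝ) 1, g p ≠ ⊥) ∧ ∃ p ∈ Icc (0 : ℝ) 1, g p ≠ ⊤

/-- Finite on `[0,1)`, left-continuous on `[0,1]`, right-continuous at `0`. -/
def IsVaRProfile (g : ℝ → EReal) : Prop :=
  IsProfile g ∧ (∀ p ∈ Ico (0 : ℝ) 1, g p ≠ ⊤) ∧
    (∀ p ∈ Ioc (0 : ℝ) 1, ContinuousWithinAt g (Iio p) p) ∧
    ContinuousWithinAt g (Ioi 0) 0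

/-- `h_g(p) = (1 - p) g(p)`, with `0 * ∞ = 0`. -/
def hFun (g : ℝ → EReal) (p : ℝ) : EReal := ((1 - p : ℝ) : EReal) * g p

/-- The class of profiles for which moreover `h_g` is concave on `(0,1)` (where it is finite)
and left-continuous at `1`. -/
def IsESProfile (g : ℝ → EReal) : Prop :=
  IsVaRProfile g ∧ ConcaveOn ℝ (Ioo 0 1) (fun p => (hFun g p).toReal) ∧
    ContinuousWithinAt (hFun g) (Iio 1) 1

/-- The acceptance set of the `g`-adjusted Expected Shortfall. -/
def acceptSet (P : Measure Ω) (g : ℝ → EReal) : Set (Ω → ℝ) :=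
  {X | Integrable X P ∧ ∀ p ∈ Icc (0 : ℝ) 1, ES P p X ≤ g p}

/-- The `g`-adjusted Expected Shortfall; the infimum of the empty set is `∞`. -/
def adjES (P : Measure Ω) (g : ℝ → EReal) (X : Ω → ℝ) : EReal :=
  sInf ((fun m : ℝ => (m : EReal)) '' {m : ℝ | (fun ω => X ω - m) ∈ acceptSet P g})

/-- `X` has ES profile `g`. -/
def HasESProfile (P : Measure Ω) (X : Ω → ℝ) (g : ℝ → EReal) : Prop :=
  ∀ p ∈ Icc (0 : ℝ) 1, ES P p X = g p

/-- Comonotonicity (up to null sets): on an event of full measure, `Y ω < Y ω'` implies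
`X ω ≤ X ω'`. -/
def Comonotonic (P : Measure Ω) (X Y : Ω → ℝ) : Prop :=
  ∃ s ∈ ae P, MonovaryOn X Y s

/-- Expectation of an extended-real random variable, with `∞ - ∞ = -∞`. -/
def expE (P : Measure Ω) (f : Ω → EReal) : EReal :=
  ((∫⁻ ω, (f ω).toENNReal ∂P : ℝ≥0∞) : EReal) - ((∫⁻ ω, (-f ω).toENNReal ∂P : ℝ≥0∞) : EReal)

/-- Second-order stochastic dominance of losses: `SSD P X Y` means that every risk-averse agent
prefers the loss `X` to the loss `Y`. -/
def SSD (P : Measure Ω) (X Y : Ω → ℝ) : Prop :=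
  ∀ v : ℝ → ℝ, Monotone v → ConcaveOn ℝ univ v →
    expE P (fun ω => (v (-Y ω) : EReal)) ≤ expE P (fun ω => (v (-X ω) : EReal))

/-- Increasing concave functions `ℝ → ℝ ∪ {-∞}` that are right-continuous. (On the interior of
`{u > -∞}` and of `{u = -∞}` continuity is automatic.) -/
def IsUtility (u : ℝ → EReal) : Prop :=
  (∀ y, u y ≠ ⊤) ∧ Monotone u ∧
    (∀ y₁ y₂ t : ℝ, 0 < t → t < 1 →
      (t : EReal) * u y₁ + ((1 - t : ℝ) : EReal) * u y₂ ≤ u (t * y₁ + (1 - t) * y₂)) ∧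
    ∀ y, ContinuousWithinAt u (Ici y) y

/-- `a` minimizes `f` over the feasible set `S`. -/
def Minimizes {α : Type*} (f : α → EReal) (S : Set α) (a : α) : Prop :=
  a ∈ S ∧ ∀ b ∈ S, f a ≤ f b

/-- `a` maximizes `f` over the feasible set `S`. -/
def Maximizes {α : Type*} (f : α → EReal) (S : Set α) (a : α) : Prop :=
  a ∈ S ∧ ∀ b ∈ S, f b ≤ f a

/-- The space of essentially bounded random variables. -/
abbrev LInf (P : Measure Ω) := Lp ℝ ∞ P

/-- The price `E_Q[w - X]`. -/
def price {P : Measure Ω} (Q : Measure Ω) (w : ℝ) (X : LInf P) : ℝ := ∫ ω, (w - X ω) ∂Q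

/-- The expected utility `E[u(w - X)]`. -/
def expUtil {P : Measure Ω} (u : ℝ → EReal) (w : ℝ) (X : LInf P) : EReal :=
  expE P (fun ω => u (w - X ω))

/-- The adjusted Expected Shortfall on `L^∞`. -/
def rho {P : Measure Ω} (g : ℝ → EReal) (X : LInf P) : EReal := adjES P g X

/-- The position `Z + z`. -/
def shift {P : Measure Ω} [IsFiniteMeasure P] (Z : LInf P) (z : ℝ) : LInf P :=
  Z + Lp.const ∞ P z

end AdjES

end

open AdjES

/-!
Everything is compared through the tail integrals `T_X(p) = ∫_p^1 VaR_q(X) dq = (1 - p) ES_p(X)`. If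
`Z` has ES profile `g`, then `ρ(X) ≤ m` says that `T_X ≤ T_{Z+m}` on `[0,1]`. So `Z + ρ(X)` is the
worst position with the risk of `X`, for every criterion that is monotone in the tail integrals.

The `ℚ`-expectation is such a criterion as long as the dominating position is comonotonic with
`dℚ/dℙ`: by the layer-cake formula `E_ℚ[X]` is an integral of the expectations of `X` over the
events `{t < dℚ/dℙ}`. Each of these is at most a tail integral of `X`, with equality under
comonotonicity.

So is the negative of expected utility: concavity gives `u(w - Z) ≤ u(w - X) + σ(w - X) (X - Z)`
with `σ` a supergradient of `u`. If `X` and `Z` are comonotonic, the expectation of the last term is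
at most `0` by the same inequality, because `σ(w - X)` increases with `X`. Expected utility depends
only on the law, so this comonotonicity can be arranged by replacing `X` and `Z` with their quantile
functions. In particular `Z + ρ(X)` is dominated by `X` in the SSD order.

On an atomless space `dℚ/dℙ` is comonotonic with a uniform variable `U`, and `Z = -h_g'(U)` has ES
profile `g` because the tail integrals of `Z` are those of `-h_g'`, that is `h_g`.
-/


noncomputable section

namespace AdjES

open ProbabilityTheory

variable {Ω : Type*} [MeasurableSpace Ω] {P : Measure Ω} {X Y Z : Ω → ℝ}

/-! ### Quantiles -/

/-- The left quantile function of `X`: the Value at Risk as a real number, which is meaningful at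
the levels in `(0,1)`. -/
def quantile (P : Measure Ω) (X : Ω → ℝ) (q : ℝ) : ℝ := (VaR P q X).toReal

lemma exists_isLeast_le_cdf (μ : Measure ℝ) {q : ℝ} (hq : q ∈ Ioo (0 : ℝ) 1) :
    ∃ s, IsLeast {t | q ≤ cdf μ t} s := by
  have hne : {t | q ≤ cdf μ t}.Nonempty :=
    ((tendsto_cdf_atTop μ).eventually (lt_mem_nhds hq.2)).exists.imp fun _ h => le_of_lt h
  obtain ⟨b, hb⟩ := ((tendsto_cdf_atBot μ).eventually (gt_mem_nhds hq.1)).exists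
  have hbdd : BddBelow {t | q ≤ cdf μ t} :=
    ⟨b, fun t ht => le_of_not_gt fun htb => (ht.trans (monotone_cdf μ htb.le)).not_gt hb⟩
  refine ⟨sInf {t | q ≤ cdf μ t}, ?_, fun t ht => csInf_le hbdd ht⟩
  have hright : Tendsto (cdf μ) (𝓝[>] (sInf {t | q ≤ cdf μ t}))
      (𝓝 (cdf μ (sInf {t | q ≤ cdf μ t}))) :=
    ((cdf μ).right_continuous _).mono Ioi_subset_Ici_self
  refine ge_of_tendsto hright ?_
  filter_upwards [self_mem_nhdsWithin] with t ht
  obtain ⟨s, hs, hst⟩ := exists_lt_of_csInf_lt hne ht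
  exact le_trans hs (monotone_cdf μ hst.le)

section ProbabilityMeasure

variable [IsProbabilityMeasure P]

lemma quantile_le_iff (hX : AEMeasurable X P) {q : ℝ} (hq : q ∈ Ioo (0 : ℝ) 1) (t : ℝ) :
    quantile P X q ≤ t ↔ q ≤ P.real {ω | X ω ≤ t} := by
  have := Measure.isProbabilityMeasure_map hX
  have hcdf (s : ℝ) : cdf (P.map X) s = P.real {ω | X ω ≤ s} := by
    rw [cdf_eq_real, map_measureReal_apply_of_aemeasurable hX measurableSet_Iic]
    rfl
  obtain ⟨s, hs⟩ := exists_isLeast_le_cdf (P.map X) hq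
  simp only [hcdf] at hs
  have hquantile : quantile P X q = s := by
    simp only [quantile, VaR, if_neg hq.1.ne', ENNReal.ofReal_le_iff_le_toReal (measure_ne_top P _)]
    exact congr_arg EReal.toReal
      (EReal.coe_strictMono.monotone.map_isLeast hs).isGLB.sInf_eq
  rw [hquantile]
  exact ⟨fun h => hs.1.trans (measureReal_mono fun ω hω => le_trans hω h), fun h => hs.2 h⟩

lemma monotoneOn_quantile (hX : AEMeasurable X P) : MonotoneOn (quantile P X) (Ioo 0 1) :=
  fun _ hp _ hq hpq => (quantile_le_iff hX hp _).2 (hpq.trans ((quantile_le_iff hX hq _).1 le_rfl))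

lemma aemeasurable_quantile (hX : AEMeasurable X P) :
    AEMeasurable (quantile P X) (volume.restrict (Ioo 0 1)) :=
  aemeasurable_restrict_of_monotoneOn measurableSet_Ioo (monotoneOn_quantile hX)

instance isProbabilityMeasure_volume_restrict_Ioo :
    IsProbabilityMeasure (volume.restrict (Ioo (0 : ℝ) 1)) := ⟨by simp⟩

lemma identDistrib_quantile (hX : AEMeasurable X P) :
    IdentDistrib (quantile P X) X (volume.restrict (Ioo 0 1)) P := by
  have := Measure.isProbabilityMeasure_map hX
  have := Measure.isProbabilityMeasure_map (aemeasurable_quantile hX)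
  refine ⟨aemeasurable_quantile hX, hX, Measure.ext_of_Iic _ _ fun t => ?_⟩
  rw [Measure.map_apply_of_aemeasurable hX measurableSet_Iic,
    Measure.map_apply_of_aemeasurable (aemeasurable_quantile hX) measurableSet_Iic,
    Measure.restrict_apply' measurableSet_Ioo]
  have hset : quantile P X ⁻¹' Iic t ∩ Ioo 0 1 = Ioc 0 (P.real {ω | X ω ≤ t}) ∩ Ioo 0 1 := by
    ext q
    simp only [mem_inter_iff, mem_preimage, mem_Iic, mem_Ioc, and_congr_left_iff]
    intro hq
    rw [quantile_le_iff hX hq, and_iff_right hq.1]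
  calc volume (quantile P X ⁻¹' Iic t ∩ Ioo 0 1)
      = volume (Ioc 0 (P.real {ω | X ω ≤ t}) ∩ Ioc 0 1) := by
        rw [hset]
        exact measure_congr ((ae_eq_refl _).inter Ioo_ae_eq_Ioc)
    _ = P (X ⁻¹' Iic t) := by
        rw [inter_eq_left.2 (Ioc_subset_Ioc_right measureReal_le_one), Real.volume_Ioc, sub_zero,
          ofReal_measureReal]
        rfl

lemma memLp_quantile (hX : MemLp X ∞ P) : MemLp (quantile P X) ∞ (volume.restrict (Ioo 0 1)) :=
  (identDistrib_quantile hX.1.aemeasurable).memLp_iff.2 hX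

lemma integrableOn_quantile (hX : MemLp X ∞ P) {p : ℝ} (hp : 0 ≤ p) :
    IntegrableOn (quantile P X) (Ioo p 1) :=
  IntegrableOn.mono_set ((memLp_quantile hX).integrable le_top) (Ioo_subset_Ioo_left hp)

lemma integral_comp_quantile (hX : AEMeasurable X P) {f : ℝ → ℝ} (hf : Measurable f) :
    ∫ q in Ioo 0 1, f (quantile P X q) = ∫ ω, f (X ω) ∂P :=
  ((identDistrib_quantile hX).comp hf).integral_eq

lemma quantile_eq_of_identDistrib {Ω' : Type*} [MeasurableSpace Ω'] {P' : Measure Ω'}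
    [IsProbabilityMeasure P'] {X' : Ω' → ℝ} (h : IdentDistrib X X' P P') {q : ℝ}
    (hq : q ∈ Ioo (0 : ℝ) 1) : quantile P X q = quantile P' X' q :=
  eq_of_forall_ge_iff fun t => by
    rw [quantile_le_iff h.aemeasurable_fst hq, quantile_le_iff h.aemeasurable_snd hq,
      measureReal_def, measureReal_def]
    exact iff_of_eq (congr_arg (fun m => q ≤ ENNReal.toReal m) (h.measure_mem_eq measurableSet_Iic))

lemma quantile_mono (hX : AEMeasurable X P) (hY : AEMeasurable Y P) (h : X ≤ᵐ[P] Y) {q : ℝ}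
    (hq : q ∈ Ioo (0 : ℝ) 1) : quantile P X q ≤ quantile P Y q := by
  refine (quantile_le_iff hX hq _).2 (((quantile_le_iff hY hq _).1 le_rfl).trans ?_)
  exact ENNReal.toReal_mono (measure_ne_top _ _) (measure_mono_ae (h.mono fun ω hω => hω.trans))

lemma quantile_add_const (hX : AEMeasurable X P) (c : ℝ) {q : ℝ} (hq : q ∈ Ioo (0 : ℝ) 1) :
    quantile P (fun ω => X ω + c) q = quantile P X q + c :=
  eq_of_forall_ge_iff fun t => by
    simp only [← le_sub_iff_add_le, quantile_le_iff (hX.add_const c) hq, quantile_le_iff hX hq]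

end ProbabilityMeasure

/-! ### Tail integrals -/

/-- The integral of the quantiles of `X` above the level `p`. It equals `(1 - p) * ES P p X` and
stays real and meaningful at `p = 1`. -/
def tail (P : Measure Ω) (X : Ω → ℝ) (p : ℝ) : ℝ := ∫ q in Ioo p 1, quantile P X q

lemma ES_eq_tail_div {p : ℝ} (hp : p < 1) :
    ES P p X = ((tail P X p / (1 - p) : ℝ) : EReal) := by
  rw [ES, if_neg hp.ne, intervalIntegral.integral_of_le hp.le, integral_Ioc_eq_integral_Ioo, tail,
    one_div_mul_eq_div]
  rfl

lemma tail_one : tail P X 1 = 0 := by simp [tail]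

lemma setIntegral_eq_tail_of_measureReal_eq_zero [IsFiniteMeasure P] {A : Set Ω}
    (hA : P.real A = 0) : ∫ ω in A, X ω ∂P = tail P X (1 - P.real A) := by
  rw [hA, sub_zero, tail_one, setIntegral_measure_zero]
  rwa [measureReal_eq_zero_iff] at hA

section ProbabilityMeasure

variable [IsProbabilityMeasure P]

lemma tail_zero (hX : AEMeasurable X P) : tail P X 0 = ∫ ω, X ω ∂P :=
  (identDistrib_quantile hX).integral_eq

lemma tail_eq_of_identDistrib {Ω' : Type*} [MeasurableSpace Ω'] {P' : Measure Ω'}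
    [IsProbabilityMeasure P'] {X' : Ω' → ℝ} (h : IdentDistrib X X' P P') {p : ℝ} (hp : 0 ≤ p) :
    tail P X p = tail P' X' p :=
  setIntegral_congr_fun measurableSet_Ioo fun _ hq =>
    quantile_eq_of_identDistrib h (Ioo_subset_Ioo_left hp hq)

lemma tail_mono (hX : MemLp X ∞ P) (hY : MemLp Y ∞ P) (h : X ≤ᵐ[P] Y) {p : ℝ} (hp : 0 ≤ p) :
    tail P X p ≤ tail P Y p :=
  setIntegral_mono_on (integrableOn_quantile hX hp) (integrableOn_quantile hY hp) measurableSet_Ioo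
    fun _ hq => quantile_mono hX.1.aemeasurable hY.1.aemeasurable h (Ioo_subset_Ioo_left hp hq)

lemma tail_add_const (hX : MemLp X ∞ P) (c : ℝ) {p : ℝ} (hp : p ∈ Icc (0 : ℝ) 1) :
    tail P (fun ω => X ω + c) p = tail P X p + (1 - p) * c := by
  rw [tail, setIntegral_congr_fun measurableSet_Ioo fun q hq =>
      quantile_add_const hX.1.aemeasurable c (Ioo_subset_Ioo_left hp.1 hq),
    integral_add (integrableOn_quantile hX hp.1) (by simp)]
  simp [tail, hp.2]

lemma tail_le_mul_add_integral_max (hX : MemLp X ∞ P) (s : ℝ) {p : ℝ}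
    (hp : p ∈ Icc (0 : ℝ) 1) :
    tail P X p ≤ (1 - p) * s + ∫ ω, max (X ω - s) 0 ∂P := by
  have hsub : Ioo p 1 ⊆ Ioo 0 1 := Ioo_subset_Ioo_left hp.1
  have hmax : IntegrableOn (fun q => max (quantile P X q - s) 0) (Ioo 0 1) :=
    ((integrableOn_quantile hX le_rfl).sub (integrable_const s)).pos_part
  calc tail P X p ≤ ∫ q in Ioo p 1, (s + max (quantile P X q - s) 0) :=
        setIntegral_mono (integrableOn_quantile hX hp.1)
          ((integrable_const s).add (hmax.mono_set hsub)) fun q =>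
            sub_le_iff_le_add'.1 (le_max_left (quantile P X q - s) 0)
    _ = (1 - p) * s + ∫ q in Ioo p 1, max (quantile P X q - s) 0 := by
        rw [integral_add (by simp) (hmax.mono_set hsub)]
        simp [hp.2]
    _ ≤ (1 - p) * s + ∫ q in Ioo 0 1, max (quantile P X q - s) 0 := by
        gcongr
        exact Eventually.of_forall fun _ => le_max_right _ _
    _ = (1 - p) * s + ∫ ω, max (X ω - s) 0 ∂P := by
        rw [integral_comp_quantile hX.1.aemeasurable (f := fun t => max (t - s) 0) (by fun_prop)]

lemma tail_eq_mul_quantile_add_integral_max (hX : MemLp X ∞ P) {p : ℝ}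
    (hp : p ∈ Ioo (0 : ℝ) 1) :
    tail P X p = (1 - p) * quantile P X p + ∫ ω, max (X ω - quantile P X p) 0 ∂P := by
  have hmono := monotoneOn_quantile hX.1.aemeasurable
  have hsub : Ioo p 1 ⊆ Ioo 0 1 := Ioo_subset_Ioo_left hp.1.le
  have hexcess : ∫ q in Ioo 0 1, max (quantile P X q - quantile P X p) 0 =
      ∫ q in Ioo p 1, (quantile P X q - quantile P X p) := by
    rw [setIntegral_congr_fun measurableSet_Ioo fun q (hq : q ∈ Ioo p 1) =>
      (max_eq_left (sub_nonneg.2 (hmono hp (hsub hq) hq.1.le))).symm]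
    refine setIntegral_eq_of_subset_of_forall_sdiff_eq_zero measurableSet_Ioo hsub fun q hq => ?_
    have hqp : q ≤ p := not_lt.1 fun hpq => hq.2 ⟨hpq, hq.1.2⟩
    exact max_eq_right (sub_nonpos.2 (hmono hq.1 hp hqp))
  rw [← integral_comp_quantile hX.1.aemeasurable (f := fun t => max (t - quantile P X p) 0)
    (by fun_prop), hexcess, integral_sub (integrableOn_quantile hX hp.1.le) (by simp)]
  simp [tail, hp.2.le]

lemma mul_quantile_le_tail (hX : MemLp X ∞ P) {p : ℝ} (hp : p ∈ Ioo (0 : ℝ) 1) :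
    (1 - p) * quantile P X p ≤ tail P X p := by
  rw [tail_eq_mul_quantile_add_integral_max hX hp]
  exact le_add_of_nonneg_right (integral_nonneg fun _ => le_max_right _ _)

lemma tail_le_of_ae_le (hX : MemLp X ∞ P) {M : ℝ} (h : ∀ᵐ ω ∂P, X ω ≤ M) {p : ℝ}
    (hp : p ∈ Icc (0 : ℝ) 1) : tail P X p ≤ (1 - p) * M := by
  have hM : ∀ᵐ q ∂volume.restrict (Ioo p 1), quantile P X q ≤ M :=
    ae_restrict_of_ae_restrict_of_subset (Ioo_subset_Ioo_left hp.1)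
      ((identDistrib_quantile hX.1.aemeasurable).symm.ae_snd measurableSet_Iic h)
  calc tail P X p ≤ ∫ _ in Ioo p 1, M :=
        integral_mono_ae (integrableOn_quantile hX hp.1) (by simp) hM
    _ = (1 - p) * M := by simp [hp.2]

lemma ae_le_of_tail_le (hX : MemLp X ∞ P) {M : ℝ}
    (h : ∀ p ∈ Ioo (0 : ℝ) 1, tail P X p ≤ (1 - p) * M) : ∀ᵐ ω ∂P, X ω ≤ M := by
  refine (identDistrib_quantile hX.1.aemeasurable).ae_snd (p := (· ≤ M)) measurableSet_Iic ?_
  filter_upwards [ae_restrict_mem measurableSet_Ioo] with p hp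
  exact le_of_mul_le_mul_left ((mul_quantile_le_tail hX hp).trans (h p hp)) (sub_pos.2 hp.2)

/-! ### Tail integrals as integrals over events -/

lemma setIntegral_eq_tail_of_measureReal_eq_one (hX : AEMeasurable X P) {A : Set Ω}
    (hA : NullMeasurableSet A P) (hA1 : P.real A = 1) :
    ∫ ω in A, X ω ∂P = tail P X (1 - P.real A) := by
  have hmem : A ∈ ae P :=
    (mem_ae_iff_prob_eq_one₀ hA).2 ((ENNReal.toReal_eq_one_iff _).1 hA1)
  rw [Measure.restrict_eq_self_of_ae_mem hmem, hA1, sub_self, tail_zero hX]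

lemma one_sub_measureReal_mem_Icc (A : Set Ω) : 1 - P.real A ∈ Icc (0 : ℝ) 1 :=
  ⟨sub_nonneg.2 measureReal_le_one, sub_le_self _ measureReal_nonneg⟩

lemma setIntegral_le_tail (hX : MemLp X ∞ P) {A : Set Ω} (hA : NullMeasurableSet A P) :
    ∫ ω in A, X ω ∂P ≤ tail P X (1 - P.real A) := by
  rcases (measureReal_nonneg (μ := P) (s := A)).eq_or_lt' with h0 | h0
  · exact (setIntegral_eq_tail_of_measureReal_eq_zero h0).le
  rcases (measureReal_le_one (μ := P) (s := A)).eq_or_lt with h1 | h1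
  · exact (setIntegral_eq_tail_of_measureReal_eq_one hX.1.aemeasurable hA h1).le
  rw [tail_eq_mul_quantile_add_integral_max hX ⟨sub_pos.2 h1, sub_lt_self _ h0⟩, sub_sub_cancel]
  set s := quantile P X (1 - P.real A)
  have hXi := hX.integrable le_top
  have hmax : Integrable (fun ω => max (X ω - s) 0) P := (hXi.sub (integrable_const s)).pos_part
  calc ∫ ω in A, X ω ∂P ≤ ∫ ω in A, (s + max (X ω - s) 0) ∂P :=
        integral_mono hXi.integrableOn ((integrable_const s).add hmax.integrableOn) fun ω =>
          sub_le_iff_le_add'.1 (le_max_left (X ω - s) 0)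
    _ = P.real A * s + ∫ ω in A, max (X ω - s) 0 ∂P := by
        rw [integral_add (integrable_const s) hmax.integrableOn]
        simp
    _ ≤ P.real A * s + ∫ ω, max (X ω - s) 0 ∂P := by
        gcongr
        · exact Eventually.of_forall fun _ => le_max_right _ _
        · exact Measure.restrict_le_self

lemma tail_le_setIntegral_of_threshold (hX : MemLp X ∞ P) {A : Set Ω}
    (hA : NullMeasurableSet A P) {s : ℝ} (hs : ∀ᵐ ω ∂P, ω ∈ A → s ≤ X ω)
    (hs' : ∀ᵐ ω ∂P, ω ∉ A → X ω ≤ s) : tail P X (1 - P.real A) ≤ ∫ ω in A, X ω ∂P := by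
  have hexcess : ∫ ω, max (X ω - s) 0 ∂P = ∫ ω in A, (X ω - s) ∂P := by
    rw [← integral_indicator₀ hA]
    refine integral_congr_ae ?_
    filter_upwards [hs, hs'] with ω h h'
    by_cases hωA : ω ∈ A
    · rw [indicator_of_mem hωA, max_eq_left (sub_nonneg.2 (h hωA))]
    · rw [indicator_of_notMem hωA, max_eq_right (sub_nonpos.2 (h' hωA))]
  refine (tail_le_mul_add_integral_max hX s (one_sub_measureReal_mem_Icc A)).trans_eq ?_
  rw [hexcess, integral_sub (hX.integrable le_top).integrableOn (integrable_const s)]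
  simp

lemma setIntegral_eq_tail (hX : MemLp X ∞ P) {A S : Set Ω} (hA : NullMeasurableSet A P)
    (hS : S ∈ ae P) (h : ∀ ω' ∈ S \ A, ∀ ω ∈ S ∩ A, X ω' ≤ X ω) :
    ∫ ω in A, X ω ∂P = tail P X (1 - P.real A) := by
  rcases (S ∩ A).eq_empty_or_nonempty with hempty | hin
  · refine setIntegral_eq_tail_of_measureReal_eq_zero ?_
    rw [measureReal_eq_zero_iff, measure_eq_zero_iff_ae_notMem]
    filter_upwards [hS] with ω hω hωA
    exact (hempty.subset ⟨hω, hωA⟩).elim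
  rcases (S \ A).eq_empty_or_nonempty with hempty | hout
  · refine setIntegral_eq_tail_of_measureReal_eq_one hX.1.aemeasurable hA ?_
    rw [measureReal_def, ENNReal.toReal_eq_one_iff, ← mem_ae_iff_prob_eq_one₀ hA]
    exact mem_of_superset hS (sdiff_eq_empty.1 hempty)
  obtain ⟨s, hs', hs⟩ := exists_between_of_forall_le (hout.image X) (hin.image X)
    (forall_mem_image.2 fun ω' hω' => forall_mem_image.2 fun ω hω => h ω' hω' ω hω)
  refine le_antisymm (setIntegral_le_tail hX hA)
    (tail_le_setIntegral_of_threshold hX hA (s := s) ?_ ?_)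
  · filter_upwards [hS] with ω hω hωA using hs (mem_image_of_mem X ⟨hω, hωA⟩)
  · filter_upwards [hS] with ω hω hωA using hs' (mem_image_of_mem X ⟨hω, hωA⟩)

end ProbabilityMeasure

/-! ### The Hardy–Littlewood inequality -/

lemma lintegral_mul_ofReal_eq_lintegral_superlevel {μ : Measure Ω} [SFinite μ] {f : Ω → ℝ≥0∞}
    {D : Ω → ℝ} (hf : AEMeasurable f μ) (hD : AEMeasurable D μ) (hD0 : 0 ≤ᵐ[μ] D) :
    ∫⁻ ω, f ω * ENNReal.ofReal (D ω) ∂μ = ∫⁻ t in Ioi (0 : ℝ), ∫⁻ ω in {ω | t < D ω}, f ω ∂μ := by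
  have hac := withDensity_absolutelyContinuous μ f
  have hlayer := lintegral_eq_lintegral_meas_lt (μ.withDensity f) (hac.ae_le hD0) (hD.mono_ac hac)
  simp_rw [withDensity_apply'] at hlayer
  rw [← hlayer, lintegral_withDensity_eq_lintegral_mul₀ hf hD.ennreal_ofReal]
  rfl

lemma integral_nonneg_iff_lintegral_ofReal_neg_le {μ : Measure Ω} {f : Ω → ℝ}
    (hf : Integrable f μ) :
    0 ≤ ∫ ω, f ω ∂μ ↔ ∫⁻ ω, ENNReal.ofReal (-f ω) ∂μ ≤ ∫⁻ ω, ENNReal.ofReal (f ω) ∂μ := by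
  rw [integral_eq_lintegral_pos_part_sub_lintegral_neg_part hf, sub_nonneg]
  exact ENNReal.toReal_le_toReal hf.neg.lintegral_lt_top.ne hf.lintegral_lt_top.ne

lemma integral_mul_nonneg_of_superlevel {μ : Measure Ω} [SFinite μ] {f D : Ω → ℝ}
    (hf : Integrable f μ) (hD : AEMeasurable D μ) (hD0 : 0 ≤ᵐ[μ] D)
    (hfD : Integrable (fun ω => f ω * D ω) μ)
    (h : ∀ t, 0 < t → 0 ≤ ∫ ω in {ω | t < D ω}, f ω ∂μ) : 0 ≤ ∫ ω, f ω * D ω ∂μ := by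
  have hmul (f : Ω → ℝ) : ∫⁻ ω, ENNReal.ofReal (f ω * D ω) ∂μ =
      ∫⁻ ω, ENNReal.ofReal (f ω) * ENNReal.ofReal (D ω) ∂μ :=
    lintegral_congr_ae (hD0.mono fun ω hω => ENNReal.ofReal_mul' hω)
  rw [integral_nonneg_iff_lintegral_ofReal_neg_le hfD]
  simp_rw [← neg_mul]
  have hneg : AEMeasurable (fun ω => -f ω) μ := hf.neg.aemeasurable
  rw [hmul, hmul, lintegral_mul_ofReal_eq_lintegral_superlevel hneg.ennreal_ofReal hD hD0,
    lintegral_mul_ofReal_eq_lintegral_superlevel hf.aemeasurable.ennreal_ofReal hD hD0]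
  exact setLIntegral_mono' measurableSet_Ioi fun t ht =>
    (integral_nonneg_iff_lintegral_ofReal_neg_le hf.integrableOn).1 (h t ht)

lemma integrable_mul_of_memLp_top {μ : Measure Ω} {f D : Ω → ℝ} (hf : MemLp f ∞ μ)
    (hD : Integrable D μ) : Integrable (fun ω => f ω * D ω) μ :=
  memLp_one_iff_integrable.1 ((memLp_one_iff_integrable.2 hD).mul hf)

lemma Comonotonic.integral_mul_le_of_tail_le [IsProbabilityMeasure P] {D : Ω → ℝ}
    (hX : MemLp X ∞ P) (hZ : MemLp Z ∞ P) (hD : Integrable D P) (hD0 : 0 ≤ᵐ[P] D)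
    (hZD : Comonotonic P Z D) (h : ∀ p ∈ Icc (0 : ℝ) 1, tail P X p ≤ tail P Z p) :
    ∫ ω, X ω * D ω ∂P ≤ ∫ ω, Z ω * D ω ∂P := by
  obtain ⟨S, hS, hmono⟩ := hZD
  have hXi := hX.integrable le_top
  have hZi := hZ.integrable le_top
  have hXD := integrable_mul_of_memLp_top hX hD
  have hZD := integrable_mul_of_memLp_top hZ hD
  rw [← sub_nonneg, ← integral_sub hZD hXD]
  simp_rw [← sub_mul]
  refine integral_mul_nonneg_of_superlevel (hZi.sub hXi) hD.aemeasurable hD0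
    (integrable_mul_of_memLp_top (hZ.sub hX) hD) fun t _ => ?_
  have hA : NullMeasurableSet {ω | t < D ω} P :=
    nullMeasurableSet_lt aemeasurable_const hD.aemeasurable
  rw [integral_sub hZi.integrableOn hXi.integrableOn, sub_nonneg,
    setIntegral_eq_tail hZ hA hS fun ω' hω' ω hω =>
      hmono hω'.1 hω.1 ((not_lt.1 hω'.2).trans_lt hω.2)]
  exact (setIntegral_le_tail hX hA).trans (h _ (one_sub_measureReal_mem_Icc _))

/-! ### Expectations of extended-real random variables -/

section ExpE

variable {f f' : Ω → EReal}

lemma expE_mono (h : ∀ᵐ ω ∂P, f ω ≤ f' ω) : expE P f ≤ expE P f' :=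
  EReal.sub_le_sub
    (EReal.coe_ennreal_le_coe_ennreal_iff.2 <|
      lintegral_mono_ae <| h.mono fun _ hω => EReal.toENNReal_le_toENNReal hω)
    (EReal.coe_ennreal_le_coe_ennreal_iff.2 <|
      lintegral_mono_ae <| h.mono fun _ hω =>
        EReal.toENNReal_le_toENNReal (EReal.neg_le_neg_iff.2 hω))

lemma expE_congr (h : f =ᵐ[P] f') : expE P f = expE P f' :=
  le_antisymm (expE_mono h.le) (expE_mono h.symm.le)

lemma expE_eq_of_identDistrib {Ω' : Type*} [MeasurableSpace Ω'] {P' : Measure Ω'}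
    {f' : Ω' → EReal} (h : IdentDistrib f f' P P') : expE P f = expE P' f' := by
  unfold expE
  congr 2
  · exact (h.comp measurable_ereal_toENNReal).lintegral_eq
  · exact (h.comp (measurable_ereal_toENNReal.comp measurable_neg)).lintegral_eq

lemma expE_coe {F : Ω → ℝ} (hF : Integrable F P) :
    expE P (fun ω => (F ω : EReal)) = ((∫ ω, F ω ∂P : ℝ) : EReal) := by
  rw [integral_eq_lintegral_pos_part_sub_lintegral_neg_part hF, EReal.coe_sub, expE]
  simp_rw [← EReal.coe_neg, EReal.real_coe_toENNReal]
  have hneg : ∫⁻ ω, ENNReal.ofReal (-F ω) ∂P ≠ ∞ := hF.neg.lintegral_lt_top.ne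
  rw [EReal.coe_ennreal_toReal hF.lintegral_lt_top.ne, EReal.coe_ennreal_toReal hneg]

lemma expE_const [IsProbabilityMeasure P] (c : EReal) : expE P (fun _ => c) = c := by
  unfold expE
  rw [lintegral_const, lintegral_const, measure_univ, mul_one, mul_one]
  rcases le_total 0 c with h | h
  · rw [EReal.coe_toENNReal h, EReal.toENNReal_of_nonpos (by simpa using h)]
    simp
  · rw [EReal.toENNReal_of_nonpos h, EReal.coe_toENNReal (by simpa using h)]
    simp

lemma lintegral_toENNReal_ne_top [IsFiniteMeasure P] {M : EReal} (hM : M ≠ ⊤)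
    (hf : ∀ᵐ ω ∂P, f ω ≤ M) : ∫⁻ ω, (f ω).toENNReal ∂P ≠ ∞ := by
  refine ne_top_of_le_ne_top ?_
    (lintegral_mono_ae (hf.mono fun ω hω => EReal.toENNReal_le_toENNReal hω))
  simp [ENNReal.mul_eq_top, hM]

lemma exists_integrable_of_expE_ne_bot [IsFiniteMeasure P] (hf : AEMeasurable f P) {M : EReal}
    (hM : M ≠ ⊤) (hfM : ∀ᵐ ω ∂P, f ω ≤ M) (h : expE P f ≠ ⊥) :
    ∃ F : Ω → ℝ, Integrable F P ∧ ∀ᵐ ω ∂P, f ω = F ω := by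
  have hpos : ∫⁻ ω, (f ω).toENNReal ∂P ≠ ∞ := lintegral_toENNReal_ne_top hM hfM
  have hneg : ∫⁻ ω, (-f ω).toENNReal ∂P ≠ ∞ := fun htop => h (by simp [expE, htop])
  refine ⟨fun ω => (f ω).toENNReal.toReal - (-f ω).toENNReal.toReal,
    (integrable_toReal_of_lintegral_ne_top hf.ereal_toENNReal hpos).sub
      (integrable_toReal_of_lintegral_ne_top hf.neg.ereal_toENNReal hneg), ?_⟩
  filter_upwards [hfM, ae_lt_top' (by fun_prop) hneg] with ω hω hω'
  have hbot : f ω ≠ ⊥ := fun hbot => by simp [hbot] at hω'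
  rw [← EReal.coe_toReal (ne_top_of_le_ne_top hM hω) hbot, ← EReal.coe_neg,
    EReal.real_coe_toENNReal, EReal.real_coe_toENNReal, ENNReal.toReal_ofReal',
    ENNReal.toReal_ofReal', max_zero_sub_eq_self]

lemma tendsto_expE_of_antitone [IsFiniteMeasure P] {f : ℕ → Ω → EReal} {F : Ω → EReal} {M : EReal}
    (hf : ∀ n, AEMeasurable (f n) P) (hM : M ≠ ⊤) (hfM : ∀ n, ∀ᵐ ω ∂P, f n ω ≤ M)
    (hanti : ∀ᵐ ω ∂P, Antitone fun n => f n ω)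
    (hlim : ∀ᵐ ω ∂P, Tendsto (fun n => f n ω) atTop (𝓝 (F ω))) :
    Tendsto (fun n => expE P (f n)) atTop (𝓝 (expE P F)) := by
  have hpos : Tendsto (fun n => ∫⁻ ω, (f n ω).toENNReal ∂P) atTop
      (𝓝 (∫⁻ ω, (F ω).toENNReal ∂P)) :=
    tendsto_lintegral_of_dominated_convergence' (fun _ => M.toENNReal)
      (fun n => (hf n).ereal_toENNReal)
      (fun n => (hfM n).mono fun ω h => EReal.toENNReal_le_toENNReal h)
      (by simp [ENNReal.mul_eq_top, hM])
      (hlim.mono fun ω h => (EReal.continuous_toENNReal.tendsto _).comp h)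
  have hneg : Tendsto (fun n => ∫⁻ ω, (-f n ω).toENNReal ∂P) atTop
      (𝓝 (∫⁻ ω, (-F ω).toENNReal ∂P)) :=
    lintegral_tendsto_of_tendsto_of_monotone (fun n => (hf n).neg.ereal_toENNReal)
      (hanti.mono fun ω h m n hmn =>
        EReal.toENNReal_le_toENNReal (EReal.neg_le_neg_iff.2 (h hmn)))
      (hlim.mono fun ω h =>
        (EReal.continuous_toENNReal.comp continuous_neg).tendsto _ |>.comp h)
  have hfin : ∫⁻ ω, (F ω).toENNReal ∂P ≠ ∞ := by
    refine lintegral_toENNReal_ne_top hM ?_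
    filter_upwards [hlim, ae_all_iff.2 hfM] with ω h h' using le_of_tendsto' h h'
  unfold expE
  simp_rw [sub_eq_add_neg]
  exact (EReal.continuousAt_add (p := (_, _)) (by simp [hfin]) (by simp)).tendsto.comp
    (((continuous_coe_ennreal_ereal.tendsto _).comp hpos).prodMk_nhds
      (((continuous_neg.comp continuous_coe_ennreal_ereal).tendsto _).comp hneg))

end ExpE

/-! ### Expected utility -/

lemma add_rightDeriv_mul_sub_le {f : ℝ → ℝ} {s : Set ℝ} (hf : ConvexOn ℝ s f) {x y : ℝ}
    (hx : x ∈ interior s) (hy : y ∈ s) : f x + derivWithin f (Ioi x) x * (y - x) ≤ f y := by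
  rcases lt_trichotomy x y with h | rfl | h
  · have hslope := hf.rightDeriv_le_slope_of_mem_interior hx hy h
    rw [slope_def_field, le_div_iff₀ (sub_pos.2 h)] at hslope
    linarith
  · simp
  · have hslope := (hf.slope_le_leftDeriv_of_mem_interior hy hx h).trans
      (hf.leftDeriv_le_rightDeriv_of_mem_interior hx)
    rw [slope_def_field, div_le_iff₀ (sub_pos.2 h)] at hslope
    linarith

lemma ae_neg_lpNorm_le (hX : MemLp X ∞ P) : ∀ᵐ ω ∂P, -lpNorm X ∞ P ≤ X ω :=
  (ae_le_lpNorm_exponent_top hX).mono fun _ => neg_le_of_abs_le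

namespace IsUtility

variable {u : ℝ → EReal} {y z : ℝ}

lemma coe_toReal (hu : IsUtility u) (hy : u y ≠ ⊥) : ((u y).toReal : EReal) = u y :=
  EReal.coe_toReal (hu.1 y) hy

lemma measurable (hu : IsUtility u) : Measurable u := hu.2.1.measurable

lemma ne_bot_of_le (hu : IsUtility u) (hy : u y ≠ ⊥) (h : y ≤ z) : u z ≠ ⊥ :=
  ne_bot_of_le_ne_bot hy (hu.2.1 h)

lemma toReal_le_toReal (hu : IsUtility u) (hy : u y ≠ ⊥) (h : y ≤ z) :
    (u y).toReal ≤ (u z).toReal :=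
  EReal.toReal_le_toReal (hu.2.1 h) hy (hu.1 z)

lemma concaveOn_toReal (hu : IsUtility u) : ConcaveOn ℝ {y | u y ≠ ⊥} fun y => (u y).toReal := by
  have hconv : Convex ℝ {y | u y ≠ ⊥} :=
    (OrdConnected.mk fun y hy z _ t ht => hu.ne_bot_of_le hy ht.1).convex
  refine concaveOn_iff_forall_pos.2 ⟨hconv, fun y hy z hz a b ha hb hab => ?_⟩
  have h := hu.2.2.1 y z a ha (by linarith)
  obtain rfl : b = 1 - a := by linarith
  change _ ≤ u (a • y + (1 - a) • z) at h
  rw [← hu.coe_toReal hy, ← hu.coe_toReal hz, ← hu.coe_toReal (hconv hy hz ha.le hb.le hab)] at h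
  exact_mod_cast h

lemma mem_interior (hu : IsUtility u) (hy : u y ≠ ⊥) (h : y < z) :
    z ∈ interior {y | u y ≠ ⊥} :=
  _root_.mem_interior.2 ⟨Ioi y, fun _ ht => hu.ne_bot_of_le hy (le_of_lt ht), isOpen_Ioi, h⟩

/-- The slopes are extended by a constant to the left of `c`, so that they are bounded. -/
lemma exists_antitone_supergradient (hu : IsUtility u) {b c : ℝ} (hb : u b ≠ ⊥) (hbc : b < c) :
    ∃ σ : ℝ → ℝ, Antitone σ ∧ (∀ y, 0 ≤ σ y) ∧ BddAbove (range σ) ∧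
      ∀ y, c ≤ y → ∀ z, u z ≤ (((u y).toReal + σ y * (z - y) : ℝ) : EReal) := by
  have hconv : ConvexOn ℝ {y | u y ≠ ⊥} (-fun y => (u y).toReal) := hu.concaveOn_toReal.neg
  have h_int (y : ℝ) : max y c ∈ interior {y | u y ≠ ⊥} :=
    hu.mem_interior hb (hbc.trans_le (le_max_right y c))
  set σ : ℝ → ℝ := fun y => -derivWithin (-fun y => (u y).toReal) (Ioi (max y c)) (max y c)
  have hσ : Antitone σ := fun y z hyz =>
    neg_le_neg (hconv.monotoneOn_rightDeriv (h_int y) (h_int z) (max_le_max_right c hyz))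
  refine ⟨σ, hσ, fun y => ?_, ⟨σ c, forall_mem_range.2 fun y => ?_⟩, fun y hy z => ?_⟩
  · have hdom := interior_subset (h_int y)
    have hle : max y c ≤ max y c + 1 := by linarith
    have h := add_rightDeriv_mul_sub_le hconv (h_int y) (hu.ne_bot_of_le hdom hle)
    have hmono := hu.toReal_le_toReal hdom hle
    simp only [Pi.neg_apply, add_sub_cancel_left, mul_one] at h
    simp only [σ]
    linarith
  · rcases le_total c y with h | h
    · exact hσ h
    · simp [σ, max_eq_right h]
  · by_cases hz : u z = ⊥
    · exact hz ▸ bot_le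
    have h := add_rightDeriv_mul_sub_le hconv (h_int y) hz
    rw [← hu.coe_toReal hz, EReal.coe_le_coe_iff]
    simp only [Pi.neg_apply, max_eq_left hy] at h
    simp only [σ, max_eq_left hy]
    linarith

lemma of_concaveOn {v : ℝ → ℝ} (hv : Monotone v) (hc : ConcaveOn ℝ univ v) :
    IsUtility (fun y => (v y : EReal)) := by
  refine ⟨fun y => EReal.coe_ne_top _, fun y z h => EReal.coe_le_coe_iff.2 (hv h),
    fun y z t h0 h1 => ?_, fun y => ?_⟩
  · have h := hc.2 (mem_univ y) (mem_univ z) h0.le (sub_nonneg.2 h1.le) (by ring)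
    rw [smul_eq_mul, smul_eq_mul] at h
    beta_reduce
    exact_mod_cast h
  · have hcont : Continuous v := continuousOn_univ.1 (hc.continuousOn isOpen_univ)
    exact (continuous_coe_real_ereal.comp hcont).continuousWithinAt

section Expectation

variable [IsProbabilityMeasure P]

lemma expE_ne_top (hu : IsUtility u) {M : ℝ} (hM : ∀ᵐ ω ∂P, -M ≤ Z ω) (y : ℝ) :
    expE P (fun ω => u (y - Z ω)) ≠ ⊤ := by
  have h : ∀ᵐ ω ∂P, u (y - Z ω) ≤ u (y + M) :=
    hM.mono fun ω hω => hu.2.1 (by linarith)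
  exact ne_top_of_le_ne_top (hu.1 (y + M)) ((expE_mono h).trans_eq (expE_const _))

lemma exists_integrable (hu : IsUtility u) {M : ℝ} (hZ : AEMeasurable Z P)
    (hM : ∀ᵐ ω ∂P, -M ≤ Z ω) (hy : expE P (fun ω => u (y - Z ω)) ≠ ⊥) :
    ∃ F : Ω → ℝ, Integrable F P ∧ ∀ᵐ ω ∂P, u (y - Z ω) = F ω :=
  exists_integrable_of_expE_ne_bot (hu.measurable.comp_aemeasurable (hZ.const_sub y))
    (hu.1 (y + M)) (hM.mono fun ω hω => hu.2.1 (by linarith)) hy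

lemma expE_concave (hu : IsUtility u) {M : ℝ} (hZ : AEMeasurable Z P)
    (hM : ∀ᵐ ω ∂P, -M ≤ Z ω) (y₁ y₂ : ℝ) {t : ℝ} (ht : 0 < t) (ht' : t < 1) :
    (t : EReal) * expE P (fun ω => u (y₁ - Z ω)) +
      ((1 - t : ℝ) : EReal) * expE P (fun ω => u (y₂ - Z ω)) ≤
      expE P (fun ω => u (t * y₁ + (1 - t) * y₂ - Z ω)) := by
  by_cases h₁ : expE P (fun ω => u (y₁ - Z ω)) = ⊥
  · rw [h₁, EReal.coe_mul_bot_of_pos ht, EReal.bot_add]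
    exact bot_le
  by_cases h₂ : expE P (fun ω => u (y₂ - Z ω)) = ⊥
  · rw [h₂, EReal.coe_mul_bot_of_pos (sub_pos.2 ht'), EReal.add_bot]
    exact bot_le
  obtain ⟨F₁, hF₁, hF₁'⟩ := hu.exists_integrable hZ hM h₁
  obtain ⟨F₂, hF₂, hF₂'⟩ := hu.exists_integrable hZ hM h₂
  have hF : Integrable (fun ω => t * F₁ ω + (1 - t) * F₂ ω) P :=
    (hF₁.const_mul t).add (hF₂.const_mul (1 - t))
  calc (t : EReal) * expE P (fun ω => u (y₁ - Z ω)) +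
        ((1 - t : ℝ) : EReal) * expE P (fun ω => u (y₂ - Z ω))
      = expE P (fun ω => ((t * F₁ ω + (1 - t) * F₂ ω : ℝ) : EReal)) := by
        rw [expE_congr hF₁', expE_congr hF₂', expE_coe hF₁, expE_coe hF₂, expE_coe hF,
          integral_add (hF₁.const_mul t) (hF₂.const_mul (1 - t)), integral_const_mul,
          integral_const_mul]
        norm_cast
    _ ≤ expE P (fun ω => u (t * y₁ + (1 - t) * y₂ - Z ω)) := by
        refine expE_mono ?_
        filter_upwards [hF₁', hF₂'] with ω h₁ h₂
        have h := hu.2.2.1 (y₁ - Z ω) (y₂ - Z ω) t ht ht'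
        rw [h₁, h₂] at h
        refine le_trans (by exact_mod_cast h) (congr_arg u ?_).le
        ring

lemma continuousWithinAt_expE (hu : IsUtility u) {M : ℝ} (hZ : AEMeasurable Z P)
    (hM : ∀ᵐ ω ∂P, -M ≤ Z ω) (y : ℝ) :
    ContinuousWithinAt (fun y => expE P (fun ω => u (y - Z ω))) (Ici y) y := by
  have hmono : Monotone fun y => expE P (fun ω => u (y - Z ω)) := fun y z hyz =>
    expE_mono (Eventually.of_forall fun ω => hu.2.1 (sub_le_sub_right hyz _))
  have hlim := hmono.tendsto_nhdsGT y
  have hseq : Tendsto (fun n : ℕ => y + 1 / ((n : ℝ) + 1)) atTop (𝓝[>] y) := by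
    refine tendsto_nhdsWithin_iff.2 ⟨?_, Eventually.of_forall fun n => ?_⟩
    · simpa using tendsto_one_div_add_atTop_nhds_zero_nat.const_add y
    · exact lt_add_of_pos_right y Nat.one_div_pos_of_nat
  have hlim' : Tendsto (fun n : ℕ => expE P (fun ω => u (y + 1 / ((n : ℝ) + 1) - Z ω))) atTop
      (𝓝 (expE P (fun ω => u (y - Z ω)))) := by
    refine tendsto_expE_of_antitone (M := u (y + 1 + M))
      (fun n => hu.measurable.comp_aemeasurable (hZ.const_sub _)) (hu.1 _)
      (fun n => hM.mono fun ω hω => hu.2.1 ?_) (Eventually.of_forall fun ω m n hmn => hu.2.1 ?_)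
      (Eventually.of_forall fun ω => ?_)
    · have : 1 / ((n : ℝ) + 1) ≤ 1 := by
        simpa using Nat.one_div_le_one_div (α := ℝ) n.zero_le
      linarith
    · gcongr
    · refine (hu.2.2.2 (y - Z ω)).tendsto.comp (tendsto_nhdsWithin_iff.2 ⟨?_, ?_⟩)
      · exact (tendsto_nhdsWithin_iff.1 hseq).1.sub_const (Z ω)
      · exact Eventually.of_forall fun n =>
          sub_le_sub_right (le_add_of_nonneg_right Nat.one_div_pos_of_nat.le) (Z ω)
  rw [← continuousWithinAt_Ioi_iff_Ici, ContinuousWithinAt,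
    ← tendsto_nhds_unique (hlim.comp hseq) hlim']
  exact hlim

lemma expE_sub (hu : IsUtility u) (hZ : MemLp Z ∞ P) :
    IsUtility fun y => expE P (fun ω => u (y - Z ω)) := by
  have hM := ae_neg_lpNorm_le hZ
  exact ⟨hu.expE_ne_top hM, fun y z hyz =>
    expE_mono (Eventually.of_forall fun ω => hu.2.1 (sub_le_sub_right hyz _)),
    fun y₁ y₂ t => hu.expE_concave hZ.1.aemeasurable hM y₁ y₂,
    hu.continuousWithinAt_expE hZ.1.aemeasurable hM⟩

end Expectation

end IsUtility

lemma ES_one_le_iff {M : ℝ} : ES P 1 X ≤ M ↔ ∀ᵐ ω ∂P, X ω ≤ M := by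
  rw [ES, if_pos rfl]
  refine ⟨fun h => ?_, fun h => essSup_le_of_ae_le _ (h.mono fun ω => EReal.coe_le_coe)⟩
  filter_upwards [ae_le_essSup (f := fun ω => (X ω : EReal)) (μ := P)] with ω hω
  exact EReal.coe_le_coe_iff.1 (hω.trans h)

lemma coe_toReal_ES_one [NeZero P] (hX : MemLp X ∞ P) :
    ((ES P 1 X).toReal : EReal) = ES P 1 X := by
  refine EReal.coe_toReal ?_ fun hbot => ?_
  · exact ne_top_of_le_ne_top (EReal.coe_ne_top _)
      (ES_one_le_iff.2 ((ae_le_lpNorm_exponent_top hX).mono fun ω => le_of_abs_le))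
  · have hlt := ES_one_le_iff.1 (hbot.trans_le bot_le : ES P 1 X ≤ ((-lpNorm X ∞ P - 1 : ℝ)))
    obtain ⟨ω, hω, hω'⟩ := ((ae_neg_lpNorm_le hX).and hlt).exists
    linarith

section TailOrder

variable [IsProbabilityMeasure P] {u : ℝ → EReal}

lemma expE_comp_quantile (hX : AEMeasurable X P) {f : ℝ → EReal} (hf : Measurable f) :
    expE (volume.restrict (Ioo 0 1)) (fun q => f (quantile P X q)) = expE P (fun ω => f (X ω)) :=
  expE_eq_of_identDistrib ((identDistrib_quantile hX).comp hf)

lemma integrable_antitone_comp_sub {σ : ℝ → ℝ} (hσ : Antitone σ) (hσ0 : ∀ y, 0 ≤ σ y)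
    (hσb : BddAbove (range σ)) (hX : AEMeasurable X P) (w : ℝ) :
    Integrable (fun ω => σ (w - X ω)) P := by
  obtain ⟨B, hB⟩ := hσb
  refine Integrable.of_bound
    (hσ.measurable.comp_aemeasurable (hX.const_sub w)).aestronglyMeasurable B
    (Eventually.of_forall fun ω => ?_)
  rw [Real.norm_of_nonneg (hσ0 _)]
  exact hB (mem_range_self _)

lemma tail_quantile (hX : AEMeasurable X P) {p : ℝ} (hp : 0 ≤ p) :
    tail (volume.restrict (Ioo 0 1)) (quantile P X) p = tail P X p :=
  tail_eq_of_identDistrib (identDistrib_quantile hX) hp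

/-- Since `Z` is comonotonic with `X`, the Hardy–Littlewood inequality applies to the marginal
utilities `σ (w - X)` and controls the error term of the first-order bound
`u (w - Z) ≤ u (w - X) + σ (w - X) * (X - Z)`. -/
lemma IsUtility.expE_le_of_comonotonic (hu : IsUtility u) (hX : MemLp X ∞ P) (hZ : MemLp Z ∞ P)
    (hcom : Comonotonic P Z X) (h : ∀ p ∈ Icc (0 : ℝ) 1, tail P X p ≤ tail P Z p) {b w K : ℝ}
    (hb : u b ≠ ⊥) (hbK : b < w - K) (hXK : ∀ᵐ ω ∂P, X ω ≤ K) :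
    expE P (fun ω => u (w - Z ω)) ≤ expE P (fun ω => u (w - X ω)) := by
  obtain ⟨σ, hσ, hσ0, hσb, hsup⟩ := hu.exists_antitone_supergradient hb hbK
  obtain ⟨S, hS, hmono⟩ := hcom
  set D : Ω → ℝ := fun ω => σ (w - X ω)
  have hD : Integrable D P := integrable_antitone_comp_sub hσ hσ0 hσb hX.1.aemeasurable w
  have hZD : Comonotonic P Z D := ⟨S, hS, fun ω hω ω' hω' hlt =>
    hmono hω hω' (lt_of_not_ge fun hle => hlt.not_ge (hσ (sub_le_sub_left hle w)))⟩
  have hrearr : ∫ ω, X ω * D ω ∂P ≤ ∫ ω, Z ω * D ω ∂P :=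
    hZD.integral_mul_le_of_tail_le hX hZ hD (Eventually.of_forall fun ω => hσ0 _) h
  obtain ⟨F, hF, hXF⟩ : ∃ F : Ω → ℝ, Integrable F P ∧ ∀ᵐ ω ∂P, u (w - X ω) = F ω := by
    refine hu.exists_integrable hX.1.aemeasurable (ae_neg_lpNorm_le hX) fun hbot => ?_
    refine hu.ne_bot_of_le hb hbK.le (le_bot_iff.1 ((expE_const (P := P) _).symm.trans_le ?_))
    exact (expE_mono (hXK.mono fun ω hω => hu.2.1 (sub_le_sub_left hω w))).trans_eq hbot
  have hdiff : Integrable (fun ω => X ω * D ω - Z ω * D ω) P :=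
    (integrable_mul_of_memLp_top hX hD).sub (integrable_mul_of_memLp_top hZ hD)
  calc expE P (fun ω => u (w - Z ω))
      ≤ expE P (fun ω => ((F ω + (X ω * D ω - Z ω * D ω) : ℝ) : EReal)) := by
        refine expE_mono ?_
        filter_upwards [hXF, hXK] with ω hω hωK
        refine (hsup (w - X ω) (sub_le_sub_left hωK w) (w - Z ω)).trans_eq ?_
        rw [hω, EReal.toReal_coe]
        congr 1
        ring
    _ = ((∫ ω, F ω ∂P + (∫ ω, X ω * D ω ∂P - ∫ ω, Z ω * D ω ∂P) : ℝ) : EReal) := by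
        rw [← integral_sub (integrable_mul_of_memLp_top hX hD) (integrable_mul_of_memLp_top hZ hD),
          ← integral_add hF hdiff]
        exact expE_coe (hF.add hdiff)
    _ ≤ ((∫ ω, F ω ∂P : ℝ) : EReal) :=
        EReal.coe_le_coe (add_le_of_nonpos_right (sub_nonpos.2 hrearr))
    _ = expE P (fun ω => u (w - X ω)) := by rw [expE_congr hXF, expE_coe hF]

lemma IsUtility.expE_le_of_tail_le_of_lt (hu : IsUtility u) (hX : MemLp X ∞ P) (hZ : MemLp Z ∞ P)
    (h : ∀ p ∈ Icc (0 : ℝ) 1, tail P X p ≤ tail P Z p) {b w K : ℝ} (hb : u b ≠ ⊥)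
    (hbK : b < w - K) (hXK : ∀ᵐ ω ∂P, X ω ≤ K) :
    expE P (fun ω => u (w - Z ω)) ≤ expE P (fun ω => u (w - X ω)) := by
  have hXm := hX.1.aemeasurable
  have hZm := hZ.1.aemeasurable
  have hum : Measurable fun t => u (w - t) := hu.measurable.comp (measurable_const_sub w)
  rw [← expE_comp_quantile hZm hum, ← expE_comp_quantile hXm hum]
  refine hu.expE_le_of_comonotonic (memLp_quantile hX) (memLp_quantile hZ)
    ⟨Ioo 0 1, self_mem_ae_restrict measurableSet_Ioo,
      (monotoneOn_quantile hZm).monovaryOn (monotoneOn_quantile hXm)⟩ (fun p hp => ?_) hb hbK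
    ((identDistrib_quantile hXm).symm.ae_snd measurableSet_Iic hXK)
  rw [tail_quantile hXm hp.1, tail_quantile hZm hp.1]
  exact h p hp

/-- The loss `Z` comes arbitrarily close to its essential supremum with positive probability. -/
lemma IsUtility.ne_bot_of_expE_ne_bot (hu : IsUtility u) (hZ : MemLp Z ∞ P) {y t : ℝ}
    (hy : expE P (fun ω => u (y - Z ω)) ≠ ⊥) (ht : y - (ES P 1 Z).toReal < t) : u t ≠ ⊥ := by
  obtain ⟨F, -, hF⟩ := hu.exists_integrable hZ.1.aemeasurable (ae_neg_lpNorm_le hZ) hy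
  have hlarge : ∃ᵐ ω ∂P, y - t < Z ω := fun hle => by
    have hES : ((ES P 1 Z).toReal : EReal) ≤ ((y - t : ℝ) : EReal) :=
      (coe_toReal_ES_one hZ).trans_le (ES_one_le_iff.2 (hle.mono fun ω => le_of_not_gt))
    linarith [EReal.coe_le_coe_iff.1 hES]
  obtain ⟨ω, hω, hFω⟩ := (hlarge.and_eventually hF).exists
  exact hu.ne_bot_of_le (hFω ▸ EReal.coe_ne_bot _) (sub_lt_comm.1 hω).le

/-- The strict inequality `b < w - K` of `expE_le_of_tail_le_of_lt` is gained by replacing `X` with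
`X - ε`, which keeps the tail integrals dominated, and is given up again by right-continuity. -/
lemma IsUtility.expE_le_of_tail_le (hu : IsUtility u) (hX : MemLp X ∞ P) (hZ : MemLp Z ∞ P)
    (h : ∀ p ∈ Icc (0 : ℝ) 1, tail P X p ≤ tail P Z p) (w : ℝ) :
    expE P (fun ω => u (w - Z ω)) ≤ expE P (fun ω => u (w - X ω)) := by
  by_cases hbot : expE P (fun ω => u (w - Z ω)) = ⊥
  · exact hbot.trans_le bot_le
  set K := (ES P 1 Z).toReal
  have hZK : ∀ᵐ ω ∂P, Z ω ≤ K := ES_one_le_iff.1 (coe_toReal_ES_one hZ).ge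
  have hXK : ∀ᵐ ω ∂P, X ω ≤ K := ae_le_of_tail_le hX fun p hp =>
    (h p (Ioo_subset_Icc_self hp)).trans (tail_le_of_ae_le hZ hZK (Ioo_subset_Icc_self hp))
  refine ge_of_tendsto ((hu.expE_sub hX).2.2.2 w |>.mono Ioi_subset_Ici_self) ?_
  filter_upwards [self_mem_nhdsWithin] with y hy
  have hε : 0 < y - w := sub_pos.2 hy
  obtain ⟨b, hwb, hby⟩ := exists_between hε
  have hb : u (w - K + b) ≠ ⊥ := hu.ne_bot_of_expE_ne_bot hZ hbot (lt_add_of_pos_right _ hwb)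
  have hX' : MemLp (fun ω => X ω + (w - y)) ∞ P := hX.add (memLp_const _)
  have htail (p : ℝ) (hp : p ∈ Icc (0 : ℝ) 1) :
      tail P (fun ω => X ω + (w - y)) p ≤ tail P Z p := by
    rw [tail_add_const hX _ hp]
    linarith [h p hp, mul_nonneg (sub_nonneg.2 hp.2) hε.le]
  calc expE P (fun ω => u (w - Z ω))
      ≤ expE P (fun ω => u (w - (X ω + (w - y)))) :=
        hu.expE_le_of_tail_le_of_lt hX' hZ htail hb (K := K + (w - y)) (by linarith)
          (hXK.mono fun ω hω => by linarith)
    _ = expE P (fun ω => u (y - X ω)) := by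
        congr! 3
        ring

lemma ssd_of_tail_le (hX : MemLp X ∞ P) (hZ : MemLp Z ∞ P)
    (h : ∀ p ∈ Icc (0 : ℝ) 1, tail P X p ≤ tail P Z p) : SSD P X Z :=
  fun v hv hc => by simpa using (IsUtility.of_concaveOn hv hc).expE_le_of_tail_le hX hZ h 0

end TailOrder

/-! ### Atomless measures -/

lemma measureReal_lt_quantile_le [IsProbabilityMeasure P] (hX : AEMeasurable X P) {q : ℝ}
    (hq : q ∈ Ioo (0 : ℝ) 1) : P.real {ω | X ω < quantile P X q} ≤ q := by
  have hlaw : P {ω | X ω < quantile P X q} =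
      volume.restrict (Ioo 0 1) {p | quantile P X p < quantile P X q} :=
    (identDistrib_quantile hX).symm.measure_mem_eq measurableSet_Iio
  have hsub : {p | quantile P X p < quantile P X q} ∩ Ioo 0 1 ⊆ Ioo 0 q := fun p hp =>
    ⟨hp.2.1, lt_of_not_ge fun h => (monotoneOn_quantile hX hq hp.2 h).not_gt hp.1⟩
  rw [measureReal_def, hlaw, Measure.restrict_apply' measurableSet_Ioo]
  refine ENNReal.toReal_le_of_le_ofReal hq.1.le ((measure_mono hsub).trans ?_)
  simp

lemma identDistrib_id_measureReal_le [IsProbabilityMeasure P] (hX : Measurable X)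
    (hX0 : ∀ t, P (X ⁻¹' {t}) = 0) :
    IdentDistrib id (fun ω => P.real (X ⁻¹' Iic (X ω))) (volume.restrict (Ioo 0 1)) P := by
  set F : ℝ → ℝ := fun t => P.real (X ⁻¹' Iic t)
  have hF : Monotone F := fun s t h => measureReal_mono (preimage_mono (Iic_subset_Iic.2 h))
  have hFq {q : ℝ} (hq : q ∈ Ioo (0 : ℝ) 1) : F (quantile P X q) = q := by
    refine le_antisymm ?_ ((quantile_le_iff hX.aemeasurable hq _).1 le_rfl)
    have hatom : P.real (X ⁻¹' {quantile P X q}) = 0 := by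
      rw [measureReal_def, hX0, ENNReal.toReal_zero]
    calc F (quantile P X q)
        ≤ P.real (X ⁻¹' Iio (quantile P X q)) + P.real (X ⁻¹' {quantile P X q}) := by
          simp only [F, ← Iio_union_right, preimage_union]
          exact measureReal_union_le _ _
      _ ≤ q := by
          rw [hatom, add_zero]
          exact measureReal_lt_quantile_le hX.aemeasurable hq
  have hcomp : IdentDistrib (fun q => F (quantile P X q)) (fun ω => F (X ω))
      (volume.restrict (Ioo 0 1)) P := (identDistrib_quantile hX.aemeasurable).comp hF.measurable
  refine (IdentDistrib.of_ae_eq aemeasurable_id ?_).trans hcomp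
  filter_upwards [ae_restrict_mem measurableSet_Ioo] with q hq using (hFq hq).symm

namespace Atomless

lemma exists_measureReal_le_half [IsFiniteMeasure P] (hP : Atomless P) {A : Set Ω}
    (hA : MeasurableSet A) (hA0 : 0 < P.real A) :
    ∃ B, MeasurableSet B ∧ B ⊆ A ∧ 0 < P.real B ∧ P.real B ≤ P.real A / 2 := by
  obtain ⟨B, hB, hBA, h0, hlt⟩ := hP A hA (ENNReal.toReal_pos_iff.1 hA0).1
  have hB0 : 0 < P.real B := ENNReal.toReal_pos h0.ne' (measure_ne_top _ _)
  have hBlt : P.real B < P.real A := ENNReal.toReal_strict_mono (measure_ne_top _ _) hlt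
  have hdiff : P.real (A \ B) = P.real A - P.real B := measureReal_sdiff hBA hB
  rcases le_total (P.real B) (P.real A / 2) with h | h
  · exact ⟨B, hB, hBA, hB0, h⟩
  · exact ⟨A \ B, hA.diff hB, sdiff_subset, by linarith, by linarith⟩

lemma exists_measureReal_lt [IsFiniteMeasure P] (hP : Atomless P) {A : Set Ω}
    (hA : MeasurableSet A) (hA0 : 0 < P.real A) {ε : ℝ} (hε : 0 < ε) :
    ∃ B, MeasurableSet B ∧ B ⊆ A ∧ 0 < P.real B ∧ P.real B < ε := by
  have halving (n : ℕ) : ∃ B, MeasurableSet B ∧ B ⊆ A ∧ 0 < P.real B ∧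
      P.real B ≤ P.real A * (1 / 2) ^ n := by
    induction n with
    | zero => exact ⟨A, hA, Subset.rfl, hA0, by simp⟩
    | succ n ih =>
      obtain ⟨B, hB, hBA, hB0, hBn⟩ := ih
      obtain ⟨C, hC, hCB, hC0, hCn⟩ := hP.exists_measureReal_le_half hB hB0
      exact ⟨C, hC, hCB.trans hBA, hC0, hCn.trans (by rw [pow_succ]; linarith)⟩
  obtain ⟨n, hn⟩ := exists_pow_lt_of_lt_one (div_pos hε hA0) one_half_lt_one
  obtain ⟨B, hB, hBA, hB0, hBn⟩ := halving n
  exact ⟨B, hB, hBA, hB0, hBn.trans_lt ((lt_div_iff₀' hA0).1 hn)⟩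

/-- Exhaustion: outside the essential union of all events of small probability there is no room
for another one. -/
lemma exists_countable_cover [IsFiniteMeasure P] (hP : Atomless P) {ε : ℝ} (hε : 0 < ε) :
    ∃ s : ℕ → Set Ω, (∀ n, MeasurableSet (s n) ∧ P.real (s n) ≤ ε) ∧ ⋃ n, s n = univ := by
  set C : Set (Set Ω) := {A | MeasurableSet A ∧ P.real A ≤ ε}
  obtain ⟨D, hDC, hD, hmax⟩ :=
    Measure.exists_ae_subset_biUnion_countable P (C := C) fun A hA => hA.1
  have hDm : MeasurableSet (⋃₀ D)ᶜ := (MeasurableSet.sUnion hD fun A hA => (hDC hA).1).compl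
  have hnull : P.real (⋃₀ D)ᶜ = 0 := by
    by_contra hne
    obtain ⟨B, hB, hBD, hB0, hBε⟩ :=
      hP.exists_measureReal_lt hDm (measureReal_nonneg.lt_of_ne' hne) hε
    have hdiff : P (B \ ⋃₀ D) = 0 := by
      simpa only [sUnion_eq_biUnion] using ae_le_set.1 (hmax B ⟨hB, hBε.le⟩)
    have hBnull : P B = 0 :=
      measure_mono_null (show B ⊆ B \ ⋃₀ D from fun ω hω => ⟨hω, hBD hω⟩) hdiff
    simp [measureReal_def, hBnull] at hB0
  obtain ⟨s, hs⟩ := (hD.insert (⋃₀ D)ᶜ).exists_eq_range (insert_nonempty _ _)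
  refine ⟨s, fun n => ?_, ?_⟩
  · rcases hs.symm.subset (mem_range_self n) with h | h
    · exact h ▸ ⟨hDm, hnull.trans_le hε.le⟩
    · exact hDC h
  · rw [← sUnion_range, ← hs, sUnion_insert, compl_union_self]

lemma exists_measurable_nat [IsFiniteMeasure P] (hP : Atomless P) {ε : ℝ} (hε : 0 < ε) :
    ∃ N : Ω → ℕ, Measurable N ∧ ∀ n, P.real (N ⁻¹' {n}) ≤ ε := by
  obtain ⟨s, hs, hcover⟩ := hP.exists_countable_cover hε
  have hmem (ω : Ω) : ∃ n, ω ∈ s n := mem_iUnion.1 (hcover ▸ mem_univ ω)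
  classical
  exact ⟨fun ω => Nat.find (hmem ω), measurable_find hmem fun n => (hs n).1, fun n =>
    (measureReal_mono fun ω hω => hω ▸ Nat.find_spec (hmem ω)).trans (hs n).2⟩

/-- An atomless random variable is obtained by encoding ever finer countable partitions into a
real number. -/
lemma exists_measurable_measure_preimage_eq_zero [IsFiniteMeasure P] (hP : Atomless P) :
    ∃ V : Ω → ℝ, Measurable V ∧ ∀ v, P (V ⁻¹' {v}) = 0 := by
  choose N hN hsmall using fun n : ℕ => hP.exists_measurable_nat (Nat.one_div_pos_of_nat (n := n))
  have hemb := measurableEmbedding_embeddingReal (ℕ → ℕ)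
  set V : Ω → ℝ := fun ω => embeddingReal (ℕ → ℕ) fun n => N n ω
  refine ⟨V, hemb.measurable.comp (measurable_pi_lambda _ hN), fun v => ?_⟩
  rcases (V ⁻¹' {v}).eq_empty_or_nonempty with hempty | ⟨ω₀, rfl⟩
  · rw [hempty, measure_empty]
  have hle (n : ℕ) : P.real (V ⁻¹' {V ω₀}) ≤ 1 / ((n : ℝ) + 1) :=
    (measureReal_mono fun ω hω => congr_fun (hemb.injective hω) n).trans (hsmall n (N n ω₀))
  exact measureReal_eq_zero_iff (measure_ne_top _ _) |>.1 <| le_antisymm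
    (ge_of_tendsto' tendsto_one_div_add_atTop_nhds_zero_nat hle) measureReal_nonneg

/-- The values of `Y` are spread out along the jumps of its distribution function, and at each
jump an atomless random variable separates the points of the level set. -/
lemma exists_measurable_refinement [IsFiniteMeasure P] (hP : Atomless P) (hY : Measurable Y) :
    ∃ T : Ω → ℝ, Measurable T ∧ (∀ t, P (T ⁻¹' {t}) = 0) ∧ ∀ ω ω', T ω < T ω' → Y ω ≤ Y ω' := by
  obtain ⟨V, hV, hV0⟩ := hP.exists_measurable_measure_preimage_eq_zero
  set F : ℝ → ℝ := fun y => P.real (Y ⁻¹' Iio y)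
  set G : ℝ → ℝ := fun y => P.real (Y ⁻¹' Iic y)
  have hF : Monotone F := fun y z h => measureReal_mono (preimage_mono (Iio_subset_Iio h))
  have hG : Monotone G := fun y z h => measureReal_mono (preimage_mono (Iic_subset_Iic.2 h))
  have hFG (y : ℝ) : F y ≤ G y := measureReal_mono (preimage_mono Iio_subset_Iic_self)
  have hGF {y z : ℝ} (h : y < z) : G y ≤ F z :=
    measureReal_mono (preimage_mono (Iic_subset_Iio.2 h))
  have hjump (y : ℝ) (h : G y - F y = 0) : P (Y ⁻¹' {y}) = 0 := by
    rw [← Iic_sdiff_Iio_same, preimage_sdiff, ← measureReal_eq_zero_iff (measure_ne_top _ _),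
      measureReal_sdiff (preimage_mono Iio_subset_Iic_self) (hY measurableSet_Iio)]
    exact h
  set T : Ω → ℝ := fun ω => Y ω + F (Y ω) + (G (Y ω) - F (Y ω)) * Real.sigmoid (V ω)
  have hTmeas : Measurable T :=
    (hY.add (hF.measurable.comp hY)).add (((hG.measurable.comp hY).sub (hF.measurable.comp hY)).mul
      (Real.sigmoid_monotone.measurable.comp hV))
  have hlower (ω : Ω) : Y ω + F (Y ω) ≤ T ω :=
    le_add_of_nonneg_right (mul_nonneg (sub_nonneg.2 (hFG _)) (Real.sigmoid_nonneg _))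
  have hupper (ω : Ω) : T ω ≤ Y ω + G (Y ω) := by
    linarith [mul_le_of_le_one_right (sub_nonneg.2 (hFG (Y ω))) (Real.sigmoid_le_one (V ω))]
  have hT {ω ω' : Ω} (h : Y ω < Y ω') : T ω < T ω' := by
    linarith [hupper ω, hlower ω', hGF h]
  refine ⟨T, hTmeas, fun t => ?_, fun ω ω' h => le_of_not_gt fun h' => (hT h').not_gt h⟩
  rcases (T ⁻¹' {t}).eq_empty_or_nonempty with hempty | ⟨ω₀, rfl⟩
  · rw [hempty, measure_empty]
  have hlevel {ω : Ω} (hω : T ω = T ω₀) : Y ω = Y ω₀ :=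
    le_antisymm (le_of_not_gt fun h => (hT h).ne' hω) (le_of_not_gt fun h => (hT h).ne hω)
  by_cases hp : G (Y ω₀) - F (Y ω₀) = 0
  · exact measure_mono_null (fun ω hω => hlevel hω) (hjump _ hp)
  · refine measure_mono_null (fun ω (hω : T ω = T ω₀) => ?_) (hV0 (V ω₀))
    have hsigmoid := hω
    simp only [T, hlevel hω, add_right_inj, mul_right_inj' hp] at hsigmoid
    exact Real.sigmoid_injective hsigmoid

lemma exists_uniform [IsProbabilityMeasure P] (hP : Atomless P) (hY : Measurable Y) :
    ∃ U : Ω → ℝ, IdentDistrib id U (volume.restrict (Ioo 0 1)) P ∧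
      ∀ ω ω', U ω < U ω' → Y ω ≤ Y ω' := by
  obtain ⟨T, hT, hT0, hTY⟩ := hP.exists_measurable_refinement hY
  have hmono : Monotone fun t => P.real (T ⁻¹' Iic t) := fun s t h =>
    measureReal_mono (preimage_mono (Iic_subset_Iic.2 h))
  exact ⟨fun ω => P.real (T ⁻¹' Iic (T ω)), identDistrib_id_measureReal_le hT hT0,
    fun ω ω' h => hTY ω ω' (hmono.reflect_lt h)⟩

end Atomless

/-! ### Utility levels -/

namespace IsUtility

variable {u : ℝ → EReal}

lemma lt_of_lt (hu : IsUtility u) {y y' z : ℝ} (hy : u y ≠ ⊥) (hlt : y < y') (hz : u y' < u z) :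
    u y < u y' := by
  have hyz : y' < z := hu.2.1.reflect_lt hz
  have hy' := hu.ne_bot_of_le hy hlt.le
  have hz' := hu.ne_bot_of_le hy' hyz.le
  rw [← hu.coe_toReal hy', ← hu.coe_toReal hz', EReal.coe_lt_coe_iff] at hz
  rw [← hu.coe_toReal hy, ← hu.coe_toReal hy', EReal.coe_lt_coe_iff]
  refine hu.concaveOn_toReal.left_lt_of_lt_right hy hz' ?_ hz
  rw [openSegment_eq_Ioo (hlt.trans hyz)]
  exact ⟨hlt, hyz⟩

lemma continuousAt (hu : IsUtility u) {y z : ℝ} (hy : u y ≠ ⊥) (h : y < z) : ContinuousAt u z := by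
  have h_int := hu.mem_interior hy h
  have hcont : ContinuousAt (fun y => (u y).toReal) z :=
    (hu.concaveOn_toReal.subset interior_subset hu.concaveOn_toReal.1.interior).continuousOn
      isOpen_interior |>.continuousAt (isOpen_interior.mem_nhds h_int)
  refine (continuous_coe_real_ereal.continuousAt.comp hcont).congr ?_
  filter_upwards [mem_interior_iff_mem_nhds.1 h_int] with y hy using hu.coe_toReal hy

lemma exists_eq (hu : IsUtility u) {x : ℝ} (hlo : ∃ y, u y < x) (hhi : ∃ y, x < u y)
    (hdom : ∀ a, IsGLB {y | u y ≠ ⊥} a → u a ≤ x) : ∃ y, u y = x := by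
  obtain ⟨c, hc⟩ := hlo
  obtain ⟨d, hd⟩ := hhi
  set S := {y | x ≤ u y}
  have hbdd : BddBelow S := ⟨c, fun y hy => (hu.2.1.reflect_lt (hc.trans_le hy)).le⟩
  have habove : ∀ y > sInf S, x ≤ u y := fun y hy => by
    obtain ⟨s, hs, hsy⟩ := exists_lt_of_csInf_lt ⟨d, hd.le⟩ hy
    exact le_trans hs (hu.2.1 hsy.le)
  refine ⟨sInf S, le_antisymm (le_of_not_gt fun hlt => ?_) ?_⟩
  · have hne : u (sInf S) ≠ ⊥ := (bot_le.trans_lt hlt).ne'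
    by_cases hleft : ∃ b < sInf S, u b ≠ ⊥
    · obtain ⟨b, hb, hub⟩ := hleft
      have hnear : ∀ᶠ y in 𝓝[<] sInf S, x < u y :=
        ((hu.continuousAt hub hb).eventually_const_lt hlt).filter_mono nhdsWithin_le_nhds
      obtain ⟨y, hxy, hy⟩ := (hnear.and self_mem_nhdsWithin).exists
      exact (csInf_le hbdd hxy.le).not_gt hy
    · push Not at hleft
      exact (hdom _ (IsLeast.isGLB ⟨hne, fun y hy => le_of_not_gt fun h => hy (hleft y h)⟩)).not_gt
        hlt
  · exact ge_of_tendsto ((hu.2.2.2 _).mono Ioi_subset_Ici_self)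
      (eventually_nhdsWithin_of_forall habove)

lemma existsUnique_eq (hu : IsUtility u) {x : ℝ} (hlo : ∃ y, u y < x) (hhi : ∃ y, x < u y)
    (hdom : ∀ a, IsGLB {y | u y ≠ ⊥} a → u a ≤ x) : ∃! y, u y = x := by
  obtain ⟨y, hy⟩ := hu.exists_eq hlo hhi hdom
  obtain ⟨d, hd⟩ := hhi
  have hlevel {z : ℝ} (hz : u z = x) : u z ≠ ⊥ := hz ▸ EReal.coe_ne_bot x
  refine ⟨y, hy, fun z hz => le_antisymm (le_of_not_gt fun h => ?_) (le_of_not_gt fun h => ?_)⟩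
  · exact (hu.lt_of_lt (hlevel hy) h (hz.trans_lt hd)).ne (hy.trans hz.symm)
  · exact (hu.lt_of_lt (hlevel hz) h (hy.trans_lt hd)).ne (hz.trans hy.symm)

lemma existsUnique_expE_sub_eq [IsProbabilityMeasure P] (hu : IsUtility u) (hZ : MemLp Z ∞ P)
    {lo hi : EReal} (hbot : Tendsto u atBot (𝓝 lo)) (htop : Tendsto u atTop (𝓝 hi)) {x : ℝ}
    (hlo : lo < x) (hhi : x < hi)
    (hdom : ∀ a, IsGLB {y | u y ≠ ⊥} a →
      expE P (fun ω => u (a + (ES P 1 Z).toReal - Z ω)) ≤ x) :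
    ∃! y, expE P (fun ω => u (y - Z ω)) = x := by
  set K := (ES P 1 Z).toReal
  have hZK : ∀ᵐ ω ∂P, Z ω ≤ K := ES_one_le_iff.1 (coe_toReal_ES_one hZ).ge
  have hlower (y : ℝ) : u y ≤ expE P (fun ω => u (y + K - Z ω)) :=
    (expE_const (P := P) _).ge.trans
      (expE_mono (hZK.mono fun ω hω => hu.2.1 (by linarith)))
  have hupper (y : ℝ) : expE P (fun ω => u (y - lpNorm Z ∞ P - Z ω)) ≤ u y :=
    (expE_mono ((ae_neg_lpNorm_le hZ).mono fun ω hω => hu.2.1 (by linarith))).trans_eq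
      (expE_const _)
  refine (hu.expE_sub hZ).existsUnique_eq ?_ ?_ fun a ha => ?_
  · obtain ⟨y, hy⟩ := (hbot.eventually_lt_const hlo).exists
    exact ⟨_, (hupper y).trans_lt hy⟩
  · obtain ⟨y, hy⟩ := (htop.eventually_const_lt hhi).exists
    exact ⟨_, hy.trans_le (hlower y)⟩
  · have hglb : IsGLB {y | u y ≠ ⊥} (a - K) := by
      refine ⟨fun y hy => ?_, fun c hc => ?_⟩
      · exact sub_le_iff_le_add.2 (ha.1 (ne_bot_of_le_ne_bot hy (hlower y)))
      · refine le_sub_iff_add_le.2 (ha.2 fun y hy => le_of_forall_gt_imp_ge_of_dense fun t ht => ?_)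
        exact le_sub_iff_add_le.1 (hc (hu.ne_bot_of_expE_ne_bot hZ hy (sub_lt_sub_right ht K)))
    simpa only [sub_add_cancel] using hdom (a - K) hglb

end IsUtility

/-! ### Realizing profiles -/

lemma convexOn_closure {E : Type*} [AddCommGroup E] [Module ℝ E] [TopologicalSpace E]
    [IsTopologicalAddGroup E] [ContinuousConstSMul ℝ E] {s : Set E} {f : E → ℝ}
    (hf : ConvexOn ℝ s f) (hc : ContinuousOn f (closure s)) : ConvexOn ℝ (closure s) f := by
  refine ⟨hf.1.closure, fun x hx y hy a b ha hb hab => ?_⟩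
  have hmaps : MapsTo (fun z : E × E => a • z.1 + b • z.2) (closure (s ×ˢ s)) (closure s) :=
    fun z hz => by
      rw [closure_prod_eq] at hz
      exact hf.1.closure hz.1 hz.2 ha hb hab
  have hcomb : Continuous fun z : E × E => a • z.1 + b • z.2 :=
    (continuous_fst.const_smul a).add (continuous_snd.const_smul b)
  have hfst : ContinuousOn (fun z : E × E => f z.1) (closure (s ×ˢ s)) :=
    hc.comp continuousOn_fst fun z hz => (closure_prod_eq.subset hz).1
  have hsnd : ContinuousOn (fun z : E × E => f z.2) (closure (s ×ˢ s)) :=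
    hc.comp continuousOn_snd fun z hz => (closure_prod_eq.subset hz).2
  have hle : ∀ z ∈ closure (s ×ˢ s), f (a • z.1 + b • z.2) ≤ a • f z.1 + b • f z.2 :=
    fun z hz => le_on_closure (fun z hz => hf.2 hz.1 hz.2 ha hb hab)
      (hc.comp hcomb.continuousOn hmaps) ((hfst.const_smul a).add (hsnd.const_smul b)) hz
  exact hle (x, y) (closure_prod_eq.superset ⟨hx, hy⟩)

lemma exists_monotoneOn_setIntegral_eq {k : ℝ → ℝ} {a b m M : ℝ} (hk : ConvexOn ℝ (Icc a b) k)
    (hc : ContinuousOn k (Icc a b)) (hm : ∀ p ∈ Ioo a b, m * (p - a) ≤ k p - k a)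
    (hM : ∀ p ∈ Ioo a b, k b - k p ≤ M * (b - p)) :
    ∃ φ : ℝ → ℝ, MonotoneOn φ (Ioo a b) ∧ MemLp φ ∞ (volume.restrict (Ioo a b)) ∧
      ∀ p ∈ Icc a b, ∫ q in Ioo p b, φ q = k b - k p := by
  set φ : ℝ → ℝ := fun p => derivWithin k (Ioi p) p
  have hsupport {p y : ℝ} (hp : p ∈ Ioo a b) (hy : y ∈ Icc a b) : k p + φ p * (y - p) ≤ k y :=
    add_rightDeriv_mul_sub_le hk (interior_Icc (a := a) ▸ hp) hy
  have hmono : MonotoneOn φ (Ioo a b) := by simpa only [interior_Icc] using hk.monotoneOn_rightDeriv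
  have hbound (p : ℝ) (hp : p ∈ Ioo a b) : φ p ∈ Icc m M := by
    have hab := hp.1.le.trans hp.2.le
    constructor
    · refine le_of_mul_le_mul_right ?_ (sub_pos.2 hp.1)
      linarith [hm p hp, hsupport hp (left_mem_Icc.2 hab)]
    · refine le_of_mul_le_mul_right ?_ (sub_pos.2 hp.2)
      linarith [hM p hp, hsupport hp (right_mem_Icc.2 hab)]
  have hLp : MemLp φ ∞ (volume.restrict (Ioo a b)) :=
    memLp_top_of_bound
      (aemeasurable_restrict_of_monotoneOn measurableSet_Ioo hmono).aestronglyMeasurable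
      (max |m| |M|) ((ae_restrict_mem measurableSet_Ioo).mono fun p hp =>
        abs_le_max_abs_abs (hbound p hp).1 (hbound p hp).2)
  have h_int : IntegrableOn φ (Ioo a b) := hLp.integrable le_top
  refine ⟨φ, hmono, hLp, fun p hp => ?_⟩
  rw [← integral_Ioc_eq_integral_Ioo, ← intervalIntegral.integral_of_le hp.2]
  refine intervalIntegral.integral_eq_sub_of_hasDeriv_right_of_le hp.2
    (hc.mono (Icc_subset_Icc_left hp.1)) (fun q hq => ?_)
    ((intervalIntegrable_iff_integrableOn_Ioo_of_le hp.2).2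
      (h_int.mono_set (Ioo_subset_Ioo_left hp.1)))
  refine hk.hasDerivWithinAt_rightDeriv_of_mem_interior ?_
  rw [interior_Icc]
  exact ⟨hp.1.trans_lt hq.1, hq.2⟩

lemma tail_eq_setIntegral_of_monotoneOn {φ : ℝ → ℝ} (hφ : MonotoneOn φ (Ioo 0 1))
    (hLp : MemLp φ ∞ (volume.restrict (Ioo 0 1))) {p : ℝ} (hp : p ∈ Icc (0 : ℝ) 1) :
    tail (volume.restrict (Ioo 0 1)) φ p = ∫ q in Ioo p 1, φ q := by
  have hinter : Ioi p ∩ Ioo 0 1 = Ioo p 1 := by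
    rw [← Ioi_inter_Iio, ← inter_assoc, Ioi_inter_Ioi, max_eq_left hp.1, Ioi_inter_Iio]
  have hreal : (volume.restrict (Ioo 0 1)).real (Ioi p) = 1 - p := by
    rw [measureReal_restrict_apply measurableSet_Ioi, hinter, Real.volume_real_Ioo_of_le hp.2]
  have htail := setIntegral_eq_tail (A := Ioi p) hLp measurableSet_Ioi.nullMeasurableSet
    (self_mem_ae_restrict measurableSet_Ioo) fun q hq r hr =>
      hφ hq.1 hr.1 ((not_lt.1 hq.2).trans (le_of_lt hr.2))
  rw [hreal, sub_sub_cancel, Measure.restrict_restrict measurableSet_Ioi, hinter] at htail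
  exact htail.symm

lemma Atomless.exists_comonotonic_tail_eq [IsProbabilityMeasure P] (hP : Atomless P)
    (hY : Measurable Y) {φ : ℝ → ℝ} (hφ : MonotoneOn φ (Ioo 0 1))
    (hLp : MemLp φ ∞ (volume.restrict (Ioo 0 1))) :
    ∃ Z : Ω → ℝ, MemLp Z ∞ P ∧ Comonotonic P Z Y ∧
      ∀ p ∈ Icc (0 : ℝ) 1, tail P Z p = ∫ q in Ioo p 1, φ q := by
  obtain ⟨U, hlaw, hUY⟩ := hP.exists_uniform hY
  have hlawφ : IdentDistrib φ (fun ω => φ (U ω)) (volume.restrict (Ioo 0 1)) P :=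
    hlaw.comp_of_aemeasurable (by simpa only [Measure.map_id] using hLp.1.aemeasurable)
  have hU : U ⁻¹' Ioo 0 1 ∈ ae P :=
    hlaw.ae_snd measurableSet_Ioo (ae_restrict_mem measurableSet_Ioo)
  refine ⟨fun ω => φ (U ω), hlawφ.memLp_iff.1 hLp, ⟨_, hU, fun ω hω ω' hω' h => ?_⟩, fun p hp => ?_⟩
  · exact hφ hω hω' (le_of_not_gt fun h' => (hUY _ _ h').not_gt h)
  · rw [← tail_eq_of_identDistrib hlawφ hp.1, tail_eq_setIntegral_of_monotoneOn hφ hLp hp]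

lemma ES_le_ES_one [IsProbabilityMeasure P] (hX : MemLp X ∞ P) {p : ℝ} (hp : p ∈ Ico (0 : ℝ) 1) :
    ES P p X ≤ ES P 1 X := by
  rw [ES_eq_tail_div hp.2, ← coe_toReal_ES_one hX, EReal.coe_le_coe_iff,
    div_le_iff₀' (sub_pos.2 hp.2)]
  exact tail_le_of_ae_le hX (ES_one_le_iff.1 (coe_toReal_ES_one hX).ge)
    (Ico_subset_Icc_self hp)

namespace IsESProfile

variable {g : ℝ → EReal}

lemma coe_toReal (hg : IsESProfile g) (h1 : g 1 ≠ ⊤) {p : ℝ} (hp : p ∈ Icc (0 : ℝ) 1) :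
    ((g p).toReal : EReal) = g p :=
  EReal.coe_toReal (ne_top_of_le_ne_top h1 (hg.1.1.1 hp (right_mem_Icc.2 zero_le_one) hp.2))
    (hg.1.1.2.1 p hp)

lemma monotoneOn_toReal (hg : IsESProfile g) (h1 : g 1 ≠ ⊤) :
    MonotoneOn (fun p => (g p).toReal) (Icc 0 1) := fun p hp q hq hpq => by
  rw [← EReal.coe_le_coe_iff, hg.coe_toReal h1 hp, hg.coe_toReal h1 hq]
  exact hg.1.1.1 hp hq hpq

lemma continuousWithinAt_toReal (hg : IsESProfile g) (h1 : g 1 ≠ ⊤) {p : ℝ}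
    (hp : p ∈ Icc (0 : ℝ) 1) {s : Set ℝ} (hs : ContinuousWithinAt g s p) :
    ContinuousWithinAt (fun p => (g p).toReal) s p :=
  (EReal.tendsto_toReal (hg.coe_toReal h1 hp ▸ EReal.coe_ne_top _)
    (hg.coe_toReal h1 hp ▸ EReal.coe_ne_bot _)).comp hs

lemma concaveOn_Ioo (hg : IsESProfile g) :
    ConcaveOn ℝ (Ioo 0 1) fun p => (1 - p) * (g p).toReal := by
  simpa only [hFun, EReal.toReal_mul, EReal.toReal_coe] using hg.2.1

lemma continuousOn (hg : IsESProfile g) (h1 : g 1 ≠ ⊤) :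
    ContinuousOn (fun p => (1 - p) * (g p).toReal) (Icc 0 1) := by
  have hmul {p : ℝ} {s : Set ℝ} (h : ContinuousWithinAt (fun p => (g p).toReal) s p) :
      ContinuousWithinAt (fun p => (1 - p) * (g p).toReal) s p :=
    (continuous_const.sub continuous_id).continuousWithinAt.mul h
  intro p hp
  rcases hp.1.eq_or_lt with rfl | hp0
  · exact hmul ((continuousWithinAt_Ioi_iff_Ici.1
      (hg.continuousWithinAt_toReal h1 hp hg.1.2.2.2)).mono Icc_subset_Ici_self)
  rcases hp.2.eq_or_lt with rfl | hp1
  · exact hmul ((continuousWithinAt_Iio_iff_Iic.1 (hg.continuousWithinAt_toReal h1 hp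
      (hg.1.2.2.1 1 (right_mem_Ioc.2 zero_lt_one)))).mono Icc_subset_Iic_self)
  · exact ((hg.concaveOn_Ioo.continuousOn isOpen_Ioo).continuousAt
      (isOpen_Ioo.mem_nhds ⟨hp0, hp1⟩)).continuousWithinAt

/-- The quantile function of a random variable with profile `g` is `-h_g'`. The growth condition
bounds it near `0` and finiteness of `g 1` bounds it near `1`. -/
lemma exists_quantile (hg : IsESProfile g)
    (hgb : ∃ C : ℝ, ∀ p ∈ Icc (0 : ℝ) 1, g p ≤ g 0 + ((C * p : ℝ) : EReal)) (h1 : g 1 ≠ ⊤) :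
    ∃ φ : ℝ → ℝ, MonotoneOn φ (Ioo 0 1) ∧ MemLp φ ∞ (volume.restrict (Ioo 0 1)) ∧
      ∀ p ∈ Icc (0 : ℝ) 1, ∫ q in Ioo p 1, φ q = (1 - p) * (g p).toReal := by
  obtain ⟨C, hC⟩ := hgb
  set γ : ℝ → ℝ := fun p => (g p).toReal
  have hcoe {p : ℝ} (hp : p ∈ Icc (0 : ℝ) 1) : (γ p : EReal) = g p := hg.coe_toReal h1 hp
  have h0mem : (0 : ℝ) ∈ Icc (0 : ℝ) 1 := left_mem_Icc.2 zero_le_one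
  have h1mem : (1 : ℝ) ∈ Icc (0 : ℝ) 1 := right_mem_Icc.2 zero_le_one
  have hgrowth {p : ℝ} (hp : p ∈ Icc (0 : ℝ) 1) : γ p ≤ γ 0 + C * p := by
    have hle := hC p hp
    rw [← hcoe hp, ← hcoe h0mem] at hle
    exact_mod_cast hle
  have hmono {p : ℝ} (hp : p ∈ Icc (0 : ℝ) 1) : γ p ≤ γ 1 :=
    hg.monotoneOn_toReal h1 hp h1mem hp.2
  have hcont : ContinuousOn (fun p => -((1 - p) * γ p)) (Icc 0 1) := (hg.continuousOn h1).neg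
  have hconv : ConvexOn ℝ (Icc 0 1) fun p => -((1 - p) * γ p) := by
    rw [← closure_Ioo zero_ne_one] at hcont ⊢
    exact convexOn_closure hg.concaveOn_Ioo.neg hcont
  have hlower (p : ℝ) (hp : p ∈ Ioo (0 : ℝ) 1) :
      (γ 0 - |C|) * (p - 0) ≤ -((1 - p) * γ p) - -((1 - 0) * γ 0) := by
    have hgp := mul_le_mul_of_nonneg_left (hgrowth (Ioo_subset_Icc_self hp)) (sub_nonneg.2 hp.2.le)
    have hCp : C * p * (1 - p) ≤ |C| * p :=
      calc C * p * (1 - p) ≤ |C| * p * (1 - p) :=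
            mul_le_mul_of_nonneg_right (mul_le_mul_of_nonneg_right (le_abs_self C) hp.1.le)
              (sub_nonneg.2 hp.2.le)
        _ ≤ |C| * p := mul_le_of_le_one_right (mul_nonneg (abs_nonneg C) hp.1.le)
            (sub_le_self _ hp.1.le)
    linarith
  have hupper (p : ℝ) (hp : p ∈ Ioo (0 : ℝ) 1) :
      -((1 - 1) * γ 1) - -((1 - p) * γ p) ≤ γ 1 * (1 - p) := by
    linarith [mul_le_mul_of_nonneg_left (hmono (Ioo_subset_Icc_self hp)) (sub_nonneg.2 hp.2.le)]
  obtain ⟨φ, hφ, hLp, h_int⟩ := exists_monotoneOn_setIntegral_eq hconv hcont hlower hupper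
  exact ⟨φ, hφ, hLp, fun p hp => by rw [h_int p hp]; ring⟩

lemma hasESProfile_of_tail_eq [IsProbabilityMeasure P] (hg : IsESProfile g) (h1 : g 1 ≠ ⊤)
    (hX : MemLp X ∞ P) (h : ∀ p ∈ Icc (0 : ℝ) 1, tail P X p = (1 - p) * (g p).toReal) :
    HasESProfile P X g := by
  have hES {p : ℝ} (hp : p ∈ Ico (0 : ℝ) 1) : ES P p X = g p := by
    have hp' := Ico_subset_Icc_self hp
    rw [ES_eq_tail_div hp.2, h p hp', mul_div_cancel_left₀ _ (sub_pos.2 hp.2).ne',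
      hg.coe_toReal h1 hp']
  intro p hp
  rcases hp.2.lt_or_eq with hp1 | rfl
  · exact hES ⟨hp.1, hp1⟩
  refine le_antisymm ?_ (le_of_tendsto (hg.1.2.2.1 1 (right_mem_Ioc.2 zero_lt_one)) ?_)
  · rw [← hg.coe_toReal h1 hp]
    refine ES_one_le_iff.2 (ae_le_of_tail_le hX fun q hq => ?_)
    have hq' := Ioo_subset_Icc_self hq
    rw [h q hq']
    exact mul_le_mul_of_nonneg_left (hg.monotoneOn_toReal h1 hq' hp hq.2.le) (sub_nonneg.2 hq.2.le)
  · filter_upwards [Ico_mem_nhdsLT zero_lt_one] with q hq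
    exact (hES hq).symm.le.trans (ES_le_ES_one hX hq)

end IsESProfile

lemma Comonotonic.congr_left {X X' Y : Ω → ℝ} (h : Comonotonic P X Y) (hX : X =ᵐ[P] X') :
    Comonotonic P X' Y := by
  obtain ⟨s, hs, hmono⟩ := h
  refine ⟨s ∩ {ω | X ω = X' ω}, inter_mem hs hX, fun ω hω ω' hω' hlt => ?_⟩
  rw [← show X ω = X' ω from hω.2, ← show X ω' = X' ω' from hω'.2]
  exact hmono hω.1 hω'.1 hlt

lemma IsESProfile.exists_hasESProfile_comonotonic [IsProbabilityMeasure P] {g : ℝ → EReal}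
    (hg : IsESProfile g)
    (hgb : ∃ C : ℝ, ∀ p ∈ Icc (0 : ℝ) 1, g p ≤ g 0 + ((C * p : ℝ) : EReal)) (hP : Atomless P)
    (hY : Measurable Y) : ∃ Z : LInf P, HasESProfile P Z g ∧ Comonotonic P Z Y := by
  have h1 : g 1 ≠ ⊤ := by
    obtain ⟨C, hC⟩ := hgb
    exact ne_top_of_le_ne_top
      (EReal.add_ne_top (hg.1.2.1 0 (left_mem_Ico.2 zero_lt_one)) (EReal.coe_ne_top _))
      (hC 1 (right_mem_Icc.2 zero_le_one))
  obtain ⟨φ, hφ, hLp, h_int⟩ := hg.exists_quantile hgb h1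
  obtain ⟨Z, hZ, hZY, htail⟩ := hP.exists_comonotonic_tail_eq hY hφ hLp
  have hcoe : Z =ᵐ[P] hZ.toLp Z := hZ.coeFn_toLp.symm
  refine ⟨hZ.toLp Z, hg.hasESProfile_of_tail_eq h1 (Lp.memLp _) fun p hp => ?_,
    hZY.congr_left hcoe⟩
  rw [← tail_eq_of_identDistrib (.of_ae_eq hZ.1.aemeasurable hcoe) hp.1, htail p hp, h_int p hp]

/-! ### The adjusted Expected Shortfall -/

lemma forall_ES_le_iff [IsProbabilityMeasure P] (hX : MemLp X ∞ P) (hZ : MemLp Z ∞ P) :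
    (∀ p ∈ Icc (0 : ℝ) 1, ES P p X ≤ ES P p Z) ↔
      ∀ p ∈ Icc (0 : ℝ) 1, tail P X p ≤ tail P Z p := by
  have hiff {p : ℝ} (hp : p < 1) : ES P p X ≤ ES P p Z ↔ tail P X p ≤ tail P Z p := by
    rw [ES_eq_tail_div hp, ES_eq_tail_div hp, EReal.coe_le_coe_iff,
      div_le_div_iff_of_pos_right (sub_pos.2 hp)]
  refine ⟨fun h p hp => ?_, fun h p hp => ?_⟩
  · rcases hp.2.lt_or_eq with hp1 | rfl
    · exact (hiff hp1).1 (h p hp)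
    · rw [tail_one, tail_one]
  · rcases hp.2.lt_or_eq with hp1 | rfl
    · exact (hiff hp1).2 (h p hp)
    rw [← coe_toReal_ES_one hZ, ES_one_le_iff]
    have hZ1 := ES_one_le_iff.1 (coe_toReal_ES_one hZ).ge
    exact ae_le_of_tail_le hX fun q hq =>
      (h q (Ioo_subset_Icc_self hq)).trans (tail_le_of_ae_le hZ hZ1 (Ioo_subset_Icc_self hq))

namespace HasESProfile

variable [IsProbabilityMeasure P] {g : ℝ → EReal}

lemma sub_const_mem_acceptSet_iff (hZg : HasESProfile P Z g) (hX : MemLp X ∞ P)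
    (hZ : MemLp Z ∞ P) {m : ℝ} : (fun ω => X ω - m) ∈ acceptSet P g ↔
      ∀ p ∈ Icc (0 : ℝ) 1, tail P X p ≤ tail P Z p + (1 - p) * m := by
  have hXm : MemLp (fun ω => X ω - m) ∞ P := hX.sub (memLp_const m)
  have hES : (∀ p ∈ Icc (0 : ℝ) 1, ES P p (fun ω => X ω - m) ≤ g p) ↔
      ∀ p ∈ Icc (0 : ℝ) 1, ES P p (fun ω => X ω - m) ≤ ES P p Z :=
    forall₂_congr fun p hp => by rw [hZg p hp]
  rw [acceptSet, mem_ofPred_eq, and_iff_right (hXm.integrable le_top), hES, forall_ES_le_iff hXm hZ]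
  refine forall₂_congr fun p hp => ?_
  simp_rw [sub_eq_add_neg (X _), tail_add_const hX (-m) hp, mul_neg, ← sub_eq_add_neg,
    sub_le_iff_le_add]

lemma adjES_eq_of_isLeast (hZg : HasESProfile P Z g) (hX : MemLp X ∞ P) (hZ : MemLp Z ∞ P) {m : ℝ}
    (h : IsLeast {m : ℝ | ∀ p ∈ Icc (0 : ℝ) 1, tail P X p ≤ tail P Z p + (1 - p) * m} m) :
    adjES P g X = m := by
  rw [adjES]
  simp_rw [hZg.sub_const_mem_acceptSet_iff hX hZ]
  exact (EReal.coe_strictMono.monotone.map_isLeast h).isGLB.sInf_eq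

lemma adjES_eq_of_tail_eq (hZg : HasESProfile P Z g) (hX : MemLp X ∞ P) (hZ : MemLp Z ∞ P) {z : ℝ}
    (h : ∀ p ∈ Icc (0 : ℝ) 1, tail P X p = tail P Z p + (1 - p) * z) : adjES P g X = z := by
  refine hZg.adjES_eq_of_isLeast hX hZ ⟨fun p hp => (h p hp).le, fun m hm => ?_⟩
  have h0 : (0 : ℝ) ∈ Icc (0 : ℝ) 1 := left_mem_Icc.2 zero_le_one
  linarith [h 0 h0, hm 0 h0]

lemma exists_adjES_eq (hZg : HasESProfile P Z g) (hX : MemLp X ∞ P) (hZ : MemLp Z ∞ P) :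
    ∃ m : ℝ, adjES P g X = m ∧ ∀ p ∈ Icc (0 : ℝ) 1, tail P X p ≤ tail P Z p + (1 - p) * m := by
  set S : Set ℝ := {m | ∀ p ∈ Icc (0 : ℝ) 1, tail P X p ≤ tail P Z p + (1 - p) * m}
  have hclosed : IsClosed S := by
    simp only [S, ofPred_forall]
    exact isClosed_biInter fun p _ => isClosed_le (by fun_prop) (by fun_prop)
  have hle : ∀ᵐ ω ∂P, X ω ≤ Z ω + (lpNorm X ∞ P + lpNorm Z ∞ P) := by
    filter_upwards [ae_le_lpNorm_exponent_top hX, ae_neg_lpNorm_le hZ] with ω hω hω'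
    linarith [le_of_abs_le hω]
  have hne : S.Nonempty := ⟨lpNorm X ∞ P + lpNorm Z ∞ P, fun p hp => by
    rw [← tail_add_const hZ _ hp]
    exact tail_mono hX (hZ.add (memLp_const _)) hle hp.1⟩
  have hbdd : BddBelow S := ⟨tail P X 0 - tail P Z 0, fun m hm => by
    linarith [hm 0 (left_mem_Icc.2 zero_le_one)]⟩
  have hmem := hclosed.csInf_mem hne hbdd
  exact ⟨sInf S, hZg.adjES_eq_of_isLeast hX hZ ⟨hmem, fun m hm => csInf_le hbdd hm⟩, hmem⟩

end HasESProfile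

/-! ### Translated positions -/

lemma coeFn_shift [IsFiniteMeasure P] (Z : LInf P) (z : ℝ) :
    shift Z z =ᵐ[P] fun ω => Z ω + z := by
  filter_upwards [Lp.coeFn_add Z (Lp.const ∞ P z), Lp.coeFn_const (p := ∞) (μ := P) z]
    with ω hadd hconst
  rw [shift, hadd, Pi.add_apply, hconst, Function.const_apply]

lemma Comonotonic.shift [IsFiniteMeasure P] {Z : LInf P} (h : Comonotonic P Z Y) (z : ℝ) :
    Comonotonic P (shift Z z) Y := by
  refine Comonotonic.congr_left ?_ (coeFn_shift Z z).symm
  obtain ⟨S, hS, hmono⟩ := h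
  exact ⟨S, hS, fun ω hω ω' hω' hlt => add_le_add_left (hmono hω hω' hlt) z⟩

lemma integrable_of_absolutelyContinuous {Q : Measure Ω} [IsFiniteMeasure Q] (hQ : Q ≪ P)
    (hX : MemLp X ∞ P) : Integrable X Q :=
  (memLp_top_of_bound (hX.1.mono_ac hQ) _
    (hQ.ae_le (ae_le_lpNorm_exponent_top hX))).integrable le_top

section ProbabilityMeasure

variable [IsProbabilityMeasure P] {Q : Measure Ω} [IsProbabilityMeasure Q] {w : ℝ}

lemma tail_shift (Z : LInf P) (z : ℝ) {p : ℝ} (hp : p ∈ Icc (0 : ℝ) 1) :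
    tail P (shift Z z) p = tail P Z p + (1 - p) * z := by
  rw [tail_eq_of_identDistrib (.of_ae_eq (Lp.memLp _).1.aemeasurable (coeFn_shift Z z)) hp.1,
    tail_add_const (Lp.memLp Z) z hp]

lemma expUtil_shift (u : ℝ → EReal) (w z : ℝ) (Z : LInf P) :
    expUtil u w (shift Z z) = expE P (fun ω => u (w - z - Z ω)) :=
  expE_congr ((coeFn_shift Z z).mono fun ω hω => congr_arg u (by rw [hω]; ring))

lemma price_eq (hQ : Q ≪ P) (X : LInf P) :
    price Q w X = w - ∫ ω, X ω * (Q.rnDeriv P ω).toReal ∂P := by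
  have hXQ := integrable_of_absolutelyContinuous hQ (Lp.memLp X)
  rw [price, integral_sub (integrable_const w) hXQ, ← integral_rnDeriv_smul hQ (f := X)]
  simp [mul_comm]

lemma price_shift (hQ : Q ≪ P) (Z : LInf P) (z : ℝ) :
    price Q w (shift Z z) = price Q w Z - z := by
  have h_int : Integrable (fun ω => w - Z ω) Q :=
    (integrable_const w).sub (integrable_of_absolutelyContinuous hQ (Lp.memLp Z))
  calc price Q w (shift Z z) = ∫ ω, (w - Z ω - z) ∂Q :=
        integral_congr_ae ((hQ.ae_eq (coeFn_shift Z z)).mono fun ω hω => by grind)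
    _ = price Q w Z - z := by
        rw [integral_sub h_int (integrable_const z), integral_const, probReal_univ, one_smul, price]

lemma price_shift_eq_iff (hQ : Q ≪ P) (Z : LInf P) {x : ℝ} (z : ℝ) :
    price Q w (shift Z z) = x ↔ z = price Q w Z - x := by
  rw [price_shift hQ, sub_eq_iff_eq_add, eq_sub_iff_add_eq', eq_comm]

lemma price_le_price_of_tail_le (hQ : Q ≪ P) {X Z : LInf P}
    (hZQ : Comonotonic P Z (fun ω => (Q.rnDeriv P ω).toReal))
    (h : ∀ p ∈ Icc (0 : ℝ) 1, tail P X p ≤ tail P Z p) : price Q w Z ≤ price Q w X := by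
  rw [price_eq hQ, price_eq hQ]
  exact sub_le_sub_left (hZQ.integral_mul_le_of_tail_le (Lp.memLp X) (Lp.memLp Z)
    Measure.integrable_toReal_rnDeriv (Eventually.of_forall fun _ => ENNReal.toReal_nonneg) h) w

end ProbabilityMeasure

/-! ### Optimal positions -/

namespace HasESProfile

variable [IsProbabilityMeasure P] {g : ℝ → EReal} {Z : LInf P} {w x : ℝ}

lemma rho_shift (hZ : HasESProfile P Z g) (z : ℝ) : rho g (shift Z z) = z :=
  hZ.adjES_eq_of_tail_eq (Lp.memLp _) (Lp.memLp _) fun _ hp => tail_shift Z z hp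

lemma rho_shift_eq_iff (hZ : HasESProfile P Z g) (z : ℝ) : rho g (shift Z z) = x ↔ z = x := by
  rw [hZ.rho_shift, EReal.coe_eq_coe_iff]

lemma exists_rho_eq (hZ : HasESProfile P Z g) (X : LInf P) :
    ∃ m : ℝ, rho g X = m ∧ ∀ p ∈ Icc (0 : ℝ) 1, tail P X p ≤ tail P (shift Z m) p := by
  obtain ⟨m, hm, htail⟩ := hZ.exists_adjES_eq (Lp.memLp X) (Lp.memLp Z)
  exact ⟨m, hm, fun p hp => (htail p hp).trans_eq (tail_shift Z m hp).symm⟩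

lemma tail_le_tail_shift (hZ : HasESProfile P Z g) {X : LInf P} (h : rho g X ≤ x) {p : ℝ}
    (hp : p ∈ Icc (0 : ℝ) 1) : tail P X p ≤ tail P (shift Z x) p := by
  obtain ⟨m, hm, htail⟩ := hZ.exists_rho_eq X
  refine (htail p hp).trans ?_
  rw [hm, EReal.coe_le_coe_iff] at h
  rw [tail_shift Z m hp, tail_shift Z x hp]
  gcongr
  exact sub_nonneg.2 hp.2

section Price

variable {Q : Measure Ω} [IsProbabilityMeasure Q]

lemma minimizes_rho_of_price (hZ : HasESProfile P Z g) (hQ : Q ≪ P)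
    (hZQ : Comonotonic P Z (fun ω => (Q.rnDeriv P ω).toReal)) :
    Minimizes (rho g) {X : LInf P | price Q w X ≤ x} (shift Z (price Q w Z - x)) := by
  refine ⟨((price_shift_eq_iff hQ Z _).2 rfl).le, fun X (hX : price Q w X ≤ x) => ?_⟩
  obtain ⟨m, hm, htail⟩ := hZ.exists_rho_eq X
  have hprice := (price_le_price_of_tail_le hQ (hZQ.shift m) htail).trans hX
  rw [price_shift hQ, sub_le_comm] at hprice
  rwa [hZ.rho_shift, hm, EReal.coe_le_coe_iff]

lemma minimizes_price (hZ : HasESProfile P Z g) (hQ : Q ≪ P)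
    (hZQ : Comonotonic P Z (fun ω => (Q.rnDeriv P ω).toReal)) :
    Minimizes (fun X : LInf P => (price Q w X : EReal)) {X : LInf P | rho g X ≤ x} (shift Z x) :=
  ⟨(hZ.rho_shift x).le, fun _ hX => EReal.coe_le_coe_iff.2 <|
    price_le_price_of_tail_le hQ (hZQ.shift x) fun _ => hZ.tail_le_tail_shift hX⟩

end Price

section Utility

variable {u : ℝ → EReal}

lemma expUtil_shift_le (hZ : HasESProfile P Z g) (hu : IsUtility u) {X : LInf P}
    (h : rho g X ≤ x) : expUtil u w (shift Z x) ≤ expUtil u w X :=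
  hu.expE_le_of_tail_le (Lp.memLp X) (Lp.memLp _) (fun _ => hZ.tail_le_tail_shift h) w

lemma minimizes_expUtil (hZ : HasESProfile P Z g) (hu : IsUtility u) :
    Minimizes (expUtil u w) {X : LInf P | rho g X = x} (shift Z x) :=
  ⟨hZ.rho_shift x, fun _ hX => hZ.expUtil_shift_le hu (le_of_eq hX)⟩

/-- Worsening `X` to the shift of `Z` with the same risk lowers the utility, and the level `x` is
only regained by moving that shift down. -/
lemma minimizes_rho_of_expUtil_shift_eq_iff (hZ : HasESProfile P Z g) (hu : IsUtility u) {z : ℝ}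
    (hz : ∀ z', expUtil u w (shift Z z') = x ↔ z' = z) :
    Minimizes (rho g) {X : LInf P | expUtil u w X = x} (shift Z z) := by
  refine ⟨(hz z).2 rfl, fun X (hX : expUtil u w X = x) => ?_⟩
  obtain ⟨m, hm, -⟩ := hZ.exists_rho_eq X
  rw [hZ.rho_shift, hm, EReal.coe_le_coe_iff]
  by_contra! hmz
  have hle : expUtil u w (shift Z m) ≤ x := (hZ.expUtil_shift_le hu hm.le).trans_eq hX
  have hge : x ≤ expUtil u w (shift Z m) := by
    rw [← (hz z).2 rfl, expUtil_shift, expUtil_shift]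
    exact expE_mono (Eventually.of_forall fun ω => hu.2.1 (by linarith))
  exact hmz.ne ((hz m).1 (hle.antisymm hge))

lemma existsUnique_expUtil_shift_eq (hZ : HasESProfile P Z g) (hu : IsUtility u) {lo hi : EReal}
    (hbot : Tendsto u atBot (𝓝 lo)) (htop : Tendsto u atTop (𝓝 hi)) (hlo : lo < x) (hhi : x < hi)
    (hdom : ∀ a : ℝ, IsGLB {y : ℝ | u y ≠ ⊥} a →
      expE P (fun ω => u (a + (g 1).toReal - Z ω)) ≤ x) :
    ∃ z : ℝ, ∀ z' : ℝ, expUtil u w (shift Z z') = x ↔ z' = z := by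
  rw [← hZ 1 (right_mem_Icc.2 zero_le_one)] at hdom
  obtain ⟨y, hy, hunique⟩ :=
    hu.existsUnique_expE_sub_eq (Lp.memLp Z) hbot htop hlo hhi hdom
  refine ⟨w - y, fun z' => ?_⟩
  rw [expUtil_shift]
  refine ⟨fun h => ?_, fun h => ?_⟩
  · rw [← hunique _ h, sub_sub_cancel]
  · rwa [h, sub_sub_cancel]

end Utility

lemma maximizes_of_ssd_consistent (hZ : HasESProfile P Z g) {ρ' : LInf P → EReal}
    (hρ' : ∀ X Y : LInf P, SSD P X Y → ρ' X ≤ ρ' Y) :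
    Maximizes ρ' {X : LInf P | rho g X = x} (shift Z x) :=
  ⟨hZ.rho_shift x, fun X hX => hρ' X _ <|
    ssd_of_tail_le (Lp.memLp X) (Lp.memLp _) fun _ => hZ.tail_le_tail_shift (le_of_eq hX)⟩

end HasESProfile

end AdjES

end

theorem mainTheorem3_general {Ω : Type*} [MeasurableSpace Ω]
    (P : Measure Ω) [IsProbabilityMeasure P] (Q : Measure Ω) [IsProbabilityMeasure Q] (hQ : Q ≪ P)
    (g : ℝ → EReal) (w x : ℝ) :
    (Atomless P → IsESProfile g →
      (∃ C : ℝ, ∀ p ∈ Icc (0 : ℝ) 1, g p ≤ g 0 + ((C * p : ℝ) : EReal)) →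
      ∃ Z : LInf P, HasESProfile P Z g ∧ Comonotonic P Z (fun ω => (Q.rnDeriv P ω).toReal)) ∧
    ∀ Z : LInf P, HasESProfile P Z g →
      (Comonotonic P Z (fun ω => (Q.rnDeriv P ω).toReal) →
        (∃ z : ℝ,
          Minimizes (rho g) {X : LInf P | price Q w X ≤ x} (shift Z z) ∧
          ∀ z' : ℝ, price Q w (shift Z z') = x ↔ z' = z) ∧
        (∃ z : ℝ,
          Minimizes (fun X : LInf P => (price Q w X : EReal))
            {X : LInf P | rho g X ≤ (x : EReal)} (shift Z z) ∧
          ∀ z' : ℝ, rho g (shift Z z') = (x : EReal) ↔ z' = z)) ∧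
      (∀ u : ℝ → EReal, IsUtility u →
        ∀ lo hi : EReal, Tendsto u atBot (𝓝 lo) → Tendsto u atTop (𝓝 hi) →
        lo < (x : EReal) → (x : EReal) < hi →
        (∀ a : ℝ, IsGLB {y : ℝ | u y ≠ ⊥} a →
          expE P (fun ω => u (a + (g 1).toReal - Z ω)) ≤ (x : EReal)) →
        ∃ z : ℝ,
          Minimizes (rho g) {X : LInf P | expUtil u w X = (x : EReal)} (shift Z z) ∧
          ∀ z' : ℝ, expUtil u w (shift Z z') = (x : EReal) ↔ z' = z) ∧
      (∀ u : ℝ → EReal, IsUtility u →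
        ∃ z : ℝ,
          Minimizes (expUtil u w) {X : LInf P | rho g X = (x : EReal)} (shift Z z) ∧
          ∀ z' : ℝ, rho g (shift Z z') = (x : EReal) ↔ z' = z) ∧
      (∀ ρ' : LInf P → EReal,
        (∀ X Y : LInf P, SSD P X Y → ρ' X ≤ ρ' Y) →
        ∃ z : ℝ,
          Maximizes ρ' {X : LInf P | rho g X = (x : EReal)} (shift Z z) ∧
          ∀ z' : ℝ, rho g (shift Z z') = (x : EReal) ↔ z' = z) := by
  refine ⟨fun hP hg hgb => hg.exists_hasESProfile_comonotonic hgb hP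
    (Measure.measurable_rnDeriv Q P).ennreal_toReal, fun Z hZ => ⟨fun hZQ => ⟨?A, ?B⟩, ?C, ?D, ?E⟩⟩
  case A => exact ⟨_, hZ.minimizes_rho_of_price hQ hZQ, price_shift_eq_iff hQ Z⟩
  case B => exact ⟨x, hZ.minimizes_price hQ hZQ, hZ.rho_shift_eq_iff⟩
  case C =>
    intro u hu lo hi hbot htop hlo hhi hdom
    obtain ⟨z, hz⟩ := hZ.existsUnique_expUtil_shift_eq (w := w) hu hbot htop hlo hhi hdom
    exact ⟨z, hZ.minimizes_rho_of_expUtil_shift_eq_iff hu hz, hz⟩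
  case D => exact fun u hu => ⟨x, hZ.minimizes_expUtil hu, hZ.rho_shift_eq_iff⟩
  case E => exact fun ρ' hρ' => ⟨x, hZ.maximizes_of_ssd_consistent hρ', hZ.rho_shift_eq_iff⟩

theorem mainTheorem3 {Ω : Type*} [MeasurableSpace Ω]
    (P : Measure Ω) [IsProbabilityMeasure P] (hP : Atomless P)
    (Q : Measure Ω) [IsProbabilityMeasure Q] (hQ : Q ≪ P)
    (g : ℝ → EReal) (hg : IsESProfile g)
    (hgb : ∃ C : ℝ, ∀ p ∈ Icc (0 : ℝ) 1, g p ≤ g 0 + ((C * p : ℝ) : EReal))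
    (w x : ℝ) :
    -- there is a bounded `Z` with ES profile `g` that is comonotonic with `dQ/dP`
    (∃ Z : LInf P, HasESProfile P Z g ∧
      Comonotonic P Z (fun ω => (Q.rnDeriv P ω).toReal)) ∧
    ∀ Z : LInf P, HasESProfile P Z g →
      (Comonotonic P Z (fun ω => (Q.rnDeriv P ω).toReal) →
        -- (A)
        (∃ z : ℝ,
          Minimizes (rho g) {X : LInf P | price Q w X ≤ x} (shift Z z) ∧
          ∀ z' : ℝ, price Q w (shift Z z') = x ↔ z' = z) ∧
        -- (B)
        (∃ z : ℝ,
          Minimizes (fun X : LInf P => (price Q w X : EReal))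
            {X : LInf P | rho g X ≤ (x : EReal)} (shift Z z) ∧
          ∀ z' : ℝ, rho g (shift Z z') = (x : EReal) ↔ z' = z)) ∧
      -- (C); the last hypothesis is vacuous when `u` is finite everywhere, and otherwise bounds from
      -- above the utility of the largest loss `Z + z` that stays in the (closed) domain of `u`
      (∀ u : ℝ → EReal, IsUtility u →
        ∀ lo hi : EReal, Tendsto u atBot (𝓝 lo) → Tendsto u atTop (𝓝 hi) →
        lo < (x : EReal) → (x : EReal) < hi →
        (∀ a : ℝ, IsGLB {y : ℝ | u y ≠ ⊥} a →
          expE P (fun ω => u (a + (g 1).toReal - Z ω)) ≤ (x : EReal)) →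
        ∃ z : ℝ,
          Minimizes (rho g) {X : LInf P | expUtil u w X = (x : EReal)} (shift Z z) ∧
          ∀ z' : ℝ, expUtil u w (shift Z z') = (x : EReal) ↔ z' = z) ∧
      -- (D)
      (∀ u : ℝ → EReal, IsUtility u →
        ∃ z : ℝ,
          Minimizes (expUtil u w) {X : LInf P | rho g X = (x : EReal)} (shift Z z) ∧
          ∀ z' : ℝ, rho g (shift Z z') = (x : EReal) ↔ z' = z) ∧
      -- (E)
      (∀ ρ' : LInf P → EReal,
        (∀ X Y : LInf P, SSD P X Y → ρ' X ≤ ρ' Y) → Continuous ρ' →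
        ∃ z : ℝ,
          Maximizes ρ' {X : LInf P | rho g X = (x : EReal)} (shift Z z) ∧
          ∀ z' : ℝ, rho g (shift Z z') = (x : EReal) ↔ z' = z) := by
  obtain ⟨hexists, hopt⟩ := mainTheorem3_general P Q hQ g w x
  exact ⟨hexists hP hg hgb, fun Z hZ => (hopt Z hZ).imp_right <| And.imp_right <| And.imp_right
    fun hE ρ' hρ' _ => hE ρ' hρ'⟩
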